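/- Let an o-minimal structure on the real field $(\mathbb R,<,+,\cdot)$ be given which is polynomially bounded: for every definable function $f:\mathbb R\to\mathbb R$ there is $N\in\mathbb N$ with $|f(t)|\le t^N$ for all sufficiently large $t$ (definable means definable with real parameters). Let $X,Y\subset\mathbb R^n$ be disjoint definable embedded $C^2$ submanifolds with $\dim Y=\dim X+1$, $X\subset\overline Y$, and such that $X\cup Y$ is locally closed in $\mathbb R^n$. Suppose that $(Y,X)$ is Whitney $(b)$-regular at every point $x_0\in X$, that is, with $\pi$ the nearest point retraction onto $X$ defined near $x_0$, $$\lim_{y\in Y,\;y\to x_0}\ \sup_{v\in T_{\pi(y)}X,\ \|v\|=1} d(v,T_yY)=0\qquad\text{and}\qquad \lim_{y\in Y,\;y\to x_0} d\Big(\tfrac{\pi(y)-y}{\|\pi(y)-y\|},\,T_yY\Big)=0$$ (a supremum over the empty set being $0$). Then: 1. If $x\in X$ is a point such that $Y\cap B(x,\varepsilon)$ is connected for all sufficiently small $\varepsilon>0$, then $x$ has an open neighbourhood $U$ such that $(X\cup Y)\cap U$ is an embedded $C^1$ submanifold with boundary of $\mathbb R^n$, with boundary $X\cap U$. 2. In particular,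 if this holds at every point $x\in X$, then $X\cup Y$ is an embedded $C^1$ submanifold with boundary of $\mathbb R^n$, with boundary $X$. -/

import Mathlib

open Set Filter Topology FirstOrder

noncomputable section

namespace WhitneyPawlucki

/-- The first-order structure `L` on `ℝ` is an o-minimal structure on the real field: it defines
the order, the addition and the multiplication, and every subset of `ℝ` definable with real
parameters is a finite union of intervals (order-connected sets, so points are allowed). -/
structure IsOMinimal (L : Language) [L.Structure ℝ] : Prop where
  definable_lt : (univ : Set ℝ).Definable L {v : Fin 2 → ℝ | v 0 < v 1}
  definable_add : (univ : Set ℝ).Definable L {v : Fin 3 → ℝ | v 0 + v 1 = v 2}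
  definable_mul : (univ : Set ℝ).Definable L {v : Fin 3 → ℝ | v 0 * v 1 = v 2}
  finite_union : ∀ s : Set ℝ, (univ : Set ℝ).Definable₁ L s →
    ∃ F : Set (Set ℝ), F.Finite ∧ (∀ I ∈ F, I.OrdConnected) ∧ s = ⋃₀ F

/-- Every definable function `ℝ → ℝ` is ultimately bounded by a power of the variable. -/
def IsPolynomiallyBounded (L : Language) [L.Structure ℝ] : Prop :=
  ∀ f : ℝ → ℝ, (univ : Set ℝ).Definable L {v : Fin 2 → ℝ | v 1 = f (v 0)} →
    ∃ N : ℕ, ∀ᶠ t in atTop, |f t| ≤ t ^ N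

/-- Definability (with real parameters) of a subset of Euclidean space. -/
def IsDefinable (L : Language) [L.Structure ℝ] {n : ℕ} (S : Set (EuclideanSpace ℝ (Fin n))) :
    Prop :=
  (univ : Set ℝ).Definable L {v : Fin n → ℝ | WithLp.toLp 2 v ∈ S}

/-- The coordinate subspace `ℝ^d × {0}` of `ℝ^n` (used for `d ≤ n`). -/
def flat (n d : ℕ) : Set (EuclideanSpace ℝ (Fin n)) :=
  {z | ∀ i : Fin n, d ≤ (i : ℕ) → z i = 0}

/-- The closed half-space `ℝ^d × [0, ∞) × {0}` of `ℝ^(d+1) × {0} ⊆ ℝ^n` (used for `d + 1 ≤ n`);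
its boundary is `flat n d`. -/
def halfFlat (n d : ℕ) : Set (EuclideanSpace ℝ (Fin n)) :=
  {z | z ∈ flat n (d + 1) ∧ ∀ i : Fin n, (i : ℕ) = d → 0 ≤ z i}

/-- `Φ` is a diffeomorphism of class `C^k` between open subsets of `ℝ^n`. -/
def IsDiffeo (k : WithTop ℕ∞) {n : ℕ}
    (Φ : OpenPartialHomeomorph (EuclideanSpace ℝ (Fin n)) (EuclideanSpace ℝ (Fin n))) : Prop :=
  ContDiffOn ℝ k Φ Φ.source ∧ ContDiffOn ℝ k Φ.symm Φ.target

/-- `M` is a (not necessarily closed) embedded `C^k` submanifold of `ℝ^n`, of dimension `d` at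
each of its points: locally a diffeomorphism of the ambient space straightens it. -/
def IsSubmanifold (k : WithTop ℕ∞) {n : ℕ} (d : ℕ) (M : Set (EuclideanSpace ℝ (Fin n))) : Prop :=
  d ≤ n ∧ ∀ p ∈ M, ∃ Φ : OpenPartialHomeomorph (EuclideanSpace ℝ (Fin n))
      (EuclideanSpace ℝ (Fin n)),
    p ∈ Φ.source ∧ IsDiffeo k Φ ∧ ∀ x ∈ Φ.source, (x ∈ M ↔ Φ x ∈ flat n d)

/-- `M` is an embedded `C^k` submanifold with boundary of `ℝ^n`, of dimension `d + 1`, whose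
boundary is exactly `B`. -/
def IsSubmanifoldWithBoundary (k : WithTop ℕ∞) {n : ℕ} (d : ℕ)
    (M B : Set (EuclideanSpace ℝ (Fin n))) : Prop :=
  d + 1 ≤ n ∧ B ⊆ M ∧
  (∀ p ∈ M \ B, ∃ Φ : OpenPartialHomeomorph (EuclideanSpace ℝ (Fin n))
      (EuclideanSpace ℝ (Fin n)),
    p ∈ Φ.source ∧ IsDiffeo k Φ ∧
      ∀ x ∈ Φ.source, (x ∈ M ↔ Φ x ∈ flat n (d + 1)) ∧ x ∉ B) ∧
  (∀ p ∈ B, ∃ Φ : OpenPartialHomeomorph (EuclideanSpace ℝ (Fin n)) (EuclideanSpace ℝ (Fin n)),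
    p ∈ Φ.source ∧ IsDiffeo k Φ ∧
      ∀ x ∈ Φ.source, (x ∈ M ↔ Φ x ∈ halfFlat n d) ∧ (x ∈ B ↔ Φ x ∈ flat n d))

/-- The tangent space `T_p M`. (At a point of a `C^1` submanifold the tangent cone is already a
linear subspace.) -/
def tangentSpace {n : ℕ} (M : Set (EuclideanSpace ℝ (Fin n))) (p : EuclideanSpace ℝ (Fin n)) :
    Submodule ℝ (EuclideanSpace ℝ (Fin n)) :=
  Submodule.span ℝ (tangentConeAt ℝ M p)

/-- `δ(A, B)`, the supremum of the distances to `B` of the unit vectors of `A`; it is `0` if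
`A = 0`. -/
def subspaceDist {n : ℕ} (A B : Submodule ℝ (EuclideanSpace ℝ (Fin n))) : ℝ :=
  sSup ((fun v => Metric.infDist v (B : Set (EuclideanSpace ℝ (Fin n)))) '' {v | v ∈ A ∧ ‖v‖ = 1})

/-- The distance from `T_{π(y)} X` to `T_y Y`. -/
def alpha {n : ℕ} (X Y : Set (EuclideanSpace ℝ (Fin n)))
    (π : EuclideanSpace ℝ (Fin n) → EuclideanSpace ℝ (Fin n)) (y : EuclideanSpace ℝ (Fin n)) : ℝ :=
  subspaceDist (tangentSpace X (π y)) (tangentSpace Y y)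

/-- The distance from the unit vector along `π(y) - y` to `T_y Y`. -/
def beta {n : ℕ} (Y : Set (EuclideanSpace ℝ (Fin n)))
    (π : EuclideanSpace ℝ (Fin n) → EuclideanSpace ℝ (Fin n)) (y : EuclideanSpace ℝ (Fin n)) : ℝ :=
  Metric.infDist (‖π y - y‖⁻¹ • (π y - y)) (tangentSpace Y y : Set (EuclideanSpace ℝ (Fin n)))

/-- Near `x`, the map `π` is the nearest point retraction onto `X`. (Near a point of a `C^2`
submanifold the nearest point exists and is unique, so the germ of `π` at `x` is determined.) -/
def IsNearestPointRetraction {n : ℕ} (X : Set (EuclideanSpace ℝ (Fin n)))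
    (x : EuclideanSpace ℝ (Fin n)) (π : EuclideanSpace ℝ (Fin n) → EuclideanSpace ℝ (Fin n)) :
    Prop :=
  ∀ᶠ y in 𝓝 x, π y ∈ X ∧ ∀ q ∈ X, dist y (π y) ≤ dist y q

/-- Whitney's condition `(b)` for the pair `(Y, X)` at the point `x` of `X`. -/
def WhitneyBAt {n : ℕ} (Y X : Set (EuclideanSpace ℝ (Fin n))) (x : EuclideanSpace ℝ (Fin n)) :
    Prop :=
  ∃ π : EuclideanSpace ℝ (Fin n) → EuclideanSpace ℝ (Fin n),
    IsNearestPointRetraction X x π ∧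
    Tendsto (alpha X Y π) (𝓝[Y] x) (𝓝 0) ∧ Tendsto (beta Y π) (𝓝[Y] x) (𝓝 0)

/-- `Y ∩ B(x, ε)` is connected for all sufficiently small `ε > 0`. -/
def ConnectedNear {n : ℕ} (Y : Set (EuclideanSpace ℝ (Fin n))) (x : EuclideanSpace ℝ (Fin n)) :
    Prop :=
  ∀ᶠ ε in 𝓝[>] (0 : ℝ), IsConnected (Y ∩ Metric.ball x ε)

end WhitneyPawlucki

end

/-!
Choose a linear map `P` which is a chart of `X` near `x`, with inverse `g`, and give `y` near `x`
the coordinates `(P y, ‖y - g (P y)‖)`. By condition `(b)` the tangent spaces of `Y` asymptotically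
contain `T X` and the direction of `y - g (P y)`, so on `Y` these coordinates form a proper local
homeomorphism onto a product `S × (0, δ)`, that is, a covering. It is trivial over this simply
connected base, and since `Y` is connected near `x` it has a single sheet: `Y` is the image of a
section `s`. Condition `(b)` also says that, for fixed `a`, the direction of `s (a, t) - g a` varies
less and less over `[t / 2, t]` as `t → 0`, uniformly in `a`, and this oscillation is definable and
therefore, by polynomial boundedness, at most a power of `t`. Summing over dyadic scales, the
directions at `(a, t)` converge uniformly as `t → 0`. Consequently `s` is `C¹` up to the edge
`t = 0`, and its odd extension across the edge yields a chart of `X ∪ Y` at `x`.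
-/

noncomputable section

namespace WhitneyPawlucki

section DefinableFunctions

variable {L : Language} {M : Type*} [L.Structure M] {A : Set M} {α : Type*} {f g : (α → M) → M}

lemma definableMap_pair (hf : A.DefinableFun L f) (hg : A.DefinableFun L g) :
    A.DefinableMap L fun v => ![f v, g v] := by
  intro i
  fin_cases i
  exacts [hf, hg]

lemma definable_setOf_rel {R : M → M → Prop} (hR : A.Definable L {v : Fin 2 → M | R (v 0) (v 1)})
    (hf : A.DefinableFun L f) (hg : A.DefinableFun L g) : A.Definable L {v | R (f v) (g v)} :=
  hR.preimage_map (definableMap_pair hf hg)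

lemma definableFun_of_definable_graph {op : M → M → M}
    (h : A.Definable L {v : Fin 3 → M | op (v 0) (v 1) = v 2})
    (hf : A.DefinableFun L f) (hg : A.DefinableFun L g) :
    A.DefinableFun L fun v => op (f v) (g v) := by
  have hop : A.DefinableFun L fun v : Fin 2 → M => op (v 0) (v 1) := by
    simpa [DefinableFun, Function.tupleGraph] using!
      h.preimage_comp (![some 0, some 1, none] : Fin 3 → Option (Fin 2))
  exact hop.comp (definableMap_pair hf hg)

lemma definable_setOf_forall {R S : M → M → Prop}
    (hR : A.Definable L {v : Fin 2 → M | R (v 0) (v 1)})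
    (hS : A.Definable L {v : Fin 2 → M | S (v 0) (v 1)}) :
    A.Definable L {v : Fin 2 → M | ∀ z, R (v 0) z → S (v 1) z} := by
  have h := Definable.forall_of_finite (α := Fin 2) (β := Fin 1)
    ((hR.preimage_comp ![Sum.inl 0, Sum.inr 0]).himp (hS.preimage_comp ![Sum.inl 1, Sum.inr 0]))
  convert h using 1
  ext v
  simp [Fin.forall_fin_succ_pi, himp_eq, imp_iff_or_not]

end DefinableFunctions

/-- The structure on `ℝ` defines the order and the field operations: an expansion of the real
field, with no tameness required. -/
structure ExpandsRealField (L : Language) [L.Structure ℝ] : Prop where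
  definable_lt : (univ : Set ℝ).Definable L {v : Fin 2 → ℝ | v 0 < v 1}
  definable_add : (univ : Set ℝ).Definable L {v : Fin 3 → ℝ | v 0 + v 1 = v 2}
  definable_mul : (univ : Set ℝ).Definable L {v : Fin 3 → ℝ | v 0 * v 1 = v 2}

section Definability

variable {L : Language} [L.Structure ℝ] {α : Type*}

lemma IsOMinimal.expandsRealField (hL : IsOMinimal L) : ExpandsRealField L :=
  ⟨hL.definable_lt, hL.definable_add, hL.definable_mul⟩

lemma definableFun_const (c : ℝ) : (univ : Set ℝ).DefinableFun L fun _ : α → ℝ => c :=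
  L.definableFun_const α (mem_univ c)

namespace ExpandsRealField

variable {f g : (α → ℝ) → ℝ}

lemma definableFun_add (hL : ExpandsRealField L) (hf : (univ : Set ℝ).DefinableFun L f)
    (hg : (univ : Set ℝ).DefinableFun L g) : (univ : Set ℝ).DefinableFun L fun v => f v + g v :=
  definableFun_of_definable_graph hL.definable_add hf hg

lemma definableFun_mul (hL : ExpandsRealField L) (hf : (univ : Set ℝ).DefinableFun L f)
    (hg : (univ : Set ℝ).DefinableFun L g) : (univ : Set ℝ).DefinableFun L fun v => f v * g v :=
  definableFun_of_definable_graph hL.definable_mul hf hg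

lemma definableFun_sub (hL : ExpandsRealField L) (hf : (univ : Set ℝ).DefinableFun L f)
    (hg : (univ : Set ℝ).DefinableFun L g) : (univ : Set ℝ).DefinableFun L fun v => f v - g v := by
  simpa [sub_eq_add_neg] using
    hL.definableFun_add hf (hL.definableFun_mul (definableFun_const (-1)) hg)

lemma definableFun_sum (hL : ExpandsRealField L) {ι : Type*} (s : Finset ι)
    {f : ι → (α → ℝ) → ℝ} (hf : ∀ i, (univ : Set ℝ).DefinableFun L (f i)) :
    (univ : Set ℝ).DefinableFun L fun v => ∑ i ∈ s, f i v := by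
  classical
  induction s using Finset.induction_on with
  | empty => simpa using definableFun_const 0
  | insert i s hi ih => simpa [Finset.sum_insert hi] using hL.definableFun_add (hf i) ih

lemma definable_setOf_lt (hL : ExpandsRealField L) (hf : (univ : Set ℝ).DefinableFun L f)
    (hg : (univ : Set ℝ).DefinableFun L g) : (univ : Set ℝ).Definable L {v | f v < g v} :=
  definable_setOf_rel hL.definable_lt hf hg

lemma definable_setOf_le (hL : ExpandsRealField L) (hf : (univ : Set ℝ).DefinableFun L f)
    (hg : (univ : Set ℝ).DefinableFun L g) : (univ : Set ℝ).Definable L {v | f v ≤ g v} := by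
  simpa only [compl_ofPred, not_lt] using (hL.definable_setOf_lt hg hf).compl

lemma definableFun_inv (hL : ExpandsRealField L) (hf : (univ : Set ℝ).DefinableFun L f) :
    (univ : Set ℝ).DefinableFun L fun v => (f v)⁻¹ := by
  have hproj (i : Option (Fin 1)) :
      (univ : Set ℝ).DefinableFun L fun v : Option (Fin 1) → ℝ => v i := DefinableFun.proj L
  have hgraph : {v : Option (Fin 1) → ℝ | (v (some 0))⁻¹ = v none} =
      {v | v (some 0) = 0} ∩ {v | v none = 0} ∪ {v | v (some 0) * v none = 1} := by
    ext v
    change (v (some 0))⁻¹ = v none ↔ (v (some 0) = 0 ∧ v none = 0) ∨ v (some 0) * v none = 1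
    rcases eq_or_ne (v (some 0)) 0 with h0 | h0
    · simp [h0, eq_comm]
    · rw [← mul_eq_one_iff_inv_eq₀ h0]
      simp [h0]
  have hinv : (univ : Set ℝ).DefinableFun L fun v : Fin 1 → ℝ => (v 0)⁻¹ := by
    have h := (((hproj (some 0)).ofPred_eq (definableFun_const 0)).inter
      ((hproj none).ofPred_eq (definableFun_const 0))).union
      ((hL.definableFun_mul (hproj (some 0)) (hproj none)).ofPred_eq (definableFun_const 1))
    rwa [← hgraph] at h
  have hmap : (univ : Set ℝ).DefinableMap L fun v => ![f v] := fun i => by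
    fin_cases i
    exact hf
  exact hinv.comp hmap

lemma definableFun_norm_sq (hL : ExpandsRealField L) {n : ℕ}
    {f : (α → ℝ) → EuclideanSpace ℝ (Fin n)}
    (hf : ∀ i, (univ : Set ℝ).DefinableFun L fun v => f v i) :
    (univ : Set ℝ).DefinableFun L fun v => ‖f v‖ ^ 2 := by
  simp only [EuclideanSpace.real_norm_sq_eq]
  simpa only [sq] using hL.definableFun_sum Finset.univ fun i => hL.definableFun_mul (hf i) (hf i)

lemma definableFun_linear (hL : ExpandsRealField L) {n : ℕ}
    (φ : EuclideanSpace ℝ (Fin n) →L[ℝ] ℝ) {f : (α → ℝ) → EuclideanSpace ℝ (Fin n)}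
    (hf : ∀ i, (univ : Set ℝ).DefinableFun L fun v => f v i) :
    (univ : Set ℝ).DefinableFun L fun v => φ (f v) := by
  convert hL.definableFun_sum Finset.univ fun i => hL.definableFun_mul (hf i)
    (definableFun_const (φ (EuclideanSpace.single i 1))) using 2 with v
  conv_lhs => rw [← (EuclideanSpace.basisFun (Fin n) ℝ).sum_repr (f v), map_sum]
  simp

lemma definable_isLUB (hL : ExpandsRealField L) {T : ℝ → Set ℝ}
    (hT : (univ : Set ℝ).Definable L {v : Fin 2 → ℝ | v 1 ∈ T (v 0)}) :
    (univ : Set ℝ).Definable L {v : Fin 2 → ℝ | IsLUB (T (v 0)) (v 1)} := by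
  have hle := hL.definable_setOf_le (α := Fin 2) (DefinableFun.proj L (i := 0))
    (DefinableFun.proj L (i := 1))
  have hge := hL.definable_setOf_le (α := Fin 2) (DefinableFun.proj L (i := 1))
    (DefinableFun.proj L (i := 0))
  have hupper : (univ : Set ℝ).Definable L {v : Fin 2 → ℝ | v 1 ∈ upperBounds (T (v 0))} :=
    definable_setOf_forall (R := fun x z => z ∈ T x) (S := fun y z => z ≤ y) hT hge
  exact hupper.inter (definable_setOf_forall (R := fun x z => z ∈ upperBounds (T x))
    (S := fun y z => y ≤ z) hupper hle)

end ExpandsRealField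

lemma IsDefinable.preimage {n : ℕ} {S : Set (EuclideanSpace ℝ (Fin n))} (hS : IsDefinable L S)
    {f : (α → ℝ) → EuclideanSpace ℝ (Fin n)}
    (hf : ∀ i, (univ : Set ℝ).DefinableFun L fun v => f v i) :
    (univ : Set ℝ).Definable L {v | f v ∈ S} :=
  hS.preimage_map (F := fun v i => f v i) hf

lemma IsPolynomiallyBounded.exists_eventually_le_pow (hpb : IsPolynomiallyBounded L)
    (hL : ExpandsRealField L) {T : ℝ → Set ℝ}
    (hT : (univ : Set ℝ).Definable L {v : Fin 2 → ℝ | v 1 ∈ T (v 0)})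
    (hne : ∀ x, (T x).Nonempty) (hbdd : ∀ x, BddAbove (T x)) :
    ∃ N : ℕ, ∀ᶠ x in atTop, ∀ z ∈ T x, z ≤ x ^ N := by
  have hlub (x : ℝ) : IsLUB (T x) (sSup (T x)) := isLUB_csSup (hne x) (hbdd x)
  have hdef : (univ : Set ℝ).Definable L {v : Fin 2 → ℝ | v 1 = sSup (T (v 0))} := by
    refine (congrArg _ (Set.ext fun v => ?_)).mpr (hL.definable_isLUB hT)
    exact ⟨fun h => (congrArg (IsLUB _) h).mpr (hlub (v 0)), fun h => h.unique (hlub _)⟩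
  obtain ⟨N, hN⟩ := hpb (fun x => sSup (T x)) hdef
  refine ⟨N, hN.mono fun x hx z hz => ?_⟩
  exact ((hlub x).1 hz).trans ((le_abs_self _).trans hx)

lemma IsPolynomiallyBounded.exists_pow_le (hpb : IsPolynomiallyBounded L)
    (hL : ExpandsRealField L) {R : ℝ → ℝ → Prop}
    (hR : (univ : Set ℝ).Definable L {v : Fin 2 → ℝ | R (v 0) (v 1)})
    (hpos : ∀ σ > 0, ∃ t₀ > 0, ∀ t, R σ t → t₀ ≤ t) :
    ∃ N : ℕ, ∃ σ₀ > 0, ∀ σ t, 0 < σ → σ < σ₀ → R σ t → σ ^ N ≤ t := by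
  -- `z ∈ T x` says that `R` holds at `(1 / x, 1 / z)`; the value `0` keeps `T x` nonempty.
  let T (x : ℝ) : Set ℝ := {z | z = 0 ∨ 0 < x ∧ R x⁻¹ z⁻¹}
  have hproj (i : Fin 2) : (univ : Set ℝ).DefinableFun L fun v : Fin 2 → ℝ => v i :=
    DefinableFun.proj L
  have hT : (univ : Set ℝ).Definable L {v : Fin 2 → ℝ | v 1 ∈ T (v 0)} :=
    ((hproj 1).ofPred_eq (definableFun_const 0)).union
      ((hL.definable_setOf_lt (definableFun_const 0) (hproj 0)).inter
        (definable_setOf_rel hR (hL.definableFun_inv (hproj 0)) (hL.definableFun_inv (hproj 1))))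
  have hbdd (x : ℝ) : BddAbove (T x) := by
    rcases le_or_gt x 0 with hx | hx
    · refine ⟨0, ?_⟩
      rintro z (rfl | ⟨hx', -⟩)
      exacts [le_rfl, absurd hx' hx.not_gt]
    · obtain ⟨t₀, ht₀, h⟩ := hpos x⁻¹ (inv_pos.2 hx)
      refine ⟨t₀⁻¹, ?_⟩
      rintro z (rfl | ⟨-, hz⟩)
      · exact (inv_pos.2 ht₀).le
      · simpa using inv_anti₀ ht₀ (h _ hz)
  obtain ⟨N, hN⟩ := hpb.exists_eventually_le_pow hL hT (fun x => ⟨0, Or.inl rfl⟩) hbdd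
  obtain ⟨M, hM⟩ := eventually_atTop.1 hN
  refine ⟨N, (max M 1)⁻¹, by positivity, fun σ t hσ hσM hRt => ?_⟩
  obtain ⟨t₀, ht₀, h₀⟩ := hpos σ hσ
  have ht : 0 < t := ht₀.trans_le (h₀ t hRt)
  have hMσ : M ≤ σ⁻¹ :=
    (le_max_left _ _).trans ((lt_inv_comm₀ hσ (by positivity)).1 hσM).le
  have hle : t⁻¹ ≤ (σ⁻¹) ^ N :=
    hM _ hMσ _ (Or.inr ⟨inv_pos.2 hσ, by simpa only [inv_inv] using hRt⟩)
  rw [inv_pow] at hle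
  exact (inv_le_inv₀ ht (by positivity)).1 hle

end Definability

section TangentSpace

variable {n : ℕ} {F : Type*} [NormedAddCommGroup F] [NormedSpace ℝ F]
  {M : Set (EuclideanSpace ℝ (Fin n))} {p : EuclideanSpace ℝ (Fin n)}

lemma fderiv_mem_tangentSpace {γ : F → EuclideanSpace ℝ (Fin n)}
    {γ' : F →L[ℝ] EuclideanSpace ℝ (Fin n)} {z : F} (hγ : HasFDerivAt γ γ' z)
    (hM : ∀ᶠ w in 𝓝 z, γ w ∈ M) (v : F) : γ' v ∈ tangentSpace M (γ z) := by
  have hv : v ∈ tangentConeAt ℝ {w | γ w ∈ M} z := by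
    rw [tangentConeAt_of_mem_nhds hM]
    trivial
  refine Submodule.subset_span (tangentConeAt_mono ?_ (hγ.hasFDerivWithinAt.mapsTo_tangent_cone hv))
  rintro _ ⟨w, hw, rfl⟩
  exact hw

lemma tangentSpace_le_ker {q : EuclideanSpace ℝ (Fin n) → F}
    {q' : EuclideanSpace ℝ (Fin n) →L[ℝ] F} (hq : HasFDerivAt q q' p)
    (h0 : ∀ᶠ x in 𝓝 p, x ∈ M → q x = 0) : tangentSpace M p ≤ q'.ker := by
  refine Submodule.span_le.2 fun w hw => ?_
  rw [← tangentConeAt_inter_nhds h0] at hw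
  have himage : q '' (M ∩ {x | x ∈ M → q x = 0}) ⊆ {0} := by
    rintro _ ⟨x, hx, rfl⟩
    exact hx.2 hx.1
  have hzero : tangentConeAt ℝ (q '' (M ∩ {x | x ∈ M → q x = 0})) (q p) ⊆ {0} :=
    tangentConeAt_subset_zero fun hacc =>
      Set.Infinite.of_accPt hacc ((Set.finite_singleton 0).subset himage)
  exact hzero (hq.hasFDerivWithinAt.mapsTo_tangent_cone hw)

end TangentSpace

section Submanifold

variable {n d : ℕ} {M : Set (EuclideanSpace ℝ (Fin n))} {p : EuclideanSpace ℝ (Fin n)}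

lemma IsDiffeo.of_le {k l : WithTop ℕ∞} (hkl : k ≤ l)
    {Φ : OpenPartialHomeomorph (EuclideanSpace ℝ (Fin n)) (EuclideanSpace ℝ (Fin n))}
    (hΦ : IsDiffeo l Φ) : IsDiffeo k Φ :=
  ⟨hΦ.1.of_le hkl, hΦ.2.of_le hkl⟩

lemma IsSubmanifold.of_le {k l : WithTop ℕ∞} (hkl : k ≤ l) (hM : IsSubmanifold l d M) :
    IsSubmanifold k d M :=
  ⟨hM.1, fun p hp => let ⟨Φ, hpΦ, hΦ, hMΦ⟩ := hM.2 p hp; ⟨Φ, hpΦ, hΦ.of_le hkl, hMΦ⟩⟩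

lemma IsDiffeo.exists_hasFDerivAt
    {Φ : OpenPartialHomeomorph (EuclideanSpace ℝ (Fin n)) (EuclideanSpace ℝ (Fin n))}
    (hΦ : IsDiffeo 1 Φ) (hp : p ∈ Φ.source) :
    ∃ e : EuclideanSpace ℝ (Fin n) ≃L[ℝ] EuclideanSpace ℝ (Fin n),
      HasFDerivAt Φ (e : _ →L[ℝ] EuclideanSpace ℝ (Fin n)) p ∧
      HasFDerivAt Φ.symm (e.symm : _ →L[ℝ] EuclideanSpace ℝ (Fin n)) (Φ p) := by
  have hd : HasFDerivAt Φ (fderiv ℝ Φ p) p :=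
    ((hΦ.1.contDiffAt (Φ.open_source.mem_nhds hp)).differentiableAt one_ne_zero).hasFDerivAt
  have hds : HasFDerivAt Φ.symm (fderiv ℝ Φ.symm (Φ p)) (Φ p) :=
    ((hΦ.2.contDiffAt (Φ.open_target.mem_nhds (Φ.map_source hp))).differentiableAt
      one_ne_zero).hasFDerivAt
  have hleft : fderiv ℝ Φ.symm (Φ p) ∘L fderiv ℝ Φ p = .id ℝ _ :=
    (hds.comp p hd).unique ((hasFDerivAt_id p).congr_of_eventuallyEq (Φ.eventually_left_inverse hp))
  have hright : fderiv ℝ Φ p ∘L fderiv ℝ Φ.symm (Φ p) = .id ℝ _ := by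
    have hd' : HasFDerivAt Φ (fderiv ℝ Φ p) (Φ.symm (Φ p)) := by rwa [Φ.left_inv hp]
    exact (hd'.comp (Φ p) hds).unique ((hasFDerivAt_id _).congr_of_eventuallyEq
      (Φ.eventually_right_inverse (Φ.map_source hp)))
  exact ⟨.equivOfInverse _ _ (fun v => congrArg (· v) hleft) (fun v => congrArg (· v) hright),
    hd, hds⟩

/-- The last `n - d` coordinates, a linear map with kernel `ℝ^d × {0}`. -/
def normalCoord (n d : ℕ) : EuclideanSpace ℝ (Fin n) →L[ℝ] (Fin (n - d) → ℝ) :=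
  ContinuousLinearMap.pi fun j => EuclideanSpace.proj (⟨d + j, by omega⟩ : Fin n)

lemma normalCoord_apply (z : EuclideanSpace ℝ (Fin n)) (j : Fin (n - d)) :
    normalCoord n d z j = z ⟨d + j, by omega⟩ := rfl

lemma normalCoord_eq_zero_iff {z : EuclideanSpace ℝ (Fin n)} :
    normalCoord n d z = 0 ↔ z ∈ flat n d := by
  refine ⟨fun h i hi => ?_, fun h => funext fun j => h _ (by simp)⟩
  simpa [normalCoord_apply, Nat.add_sub_cancel' hi] using congrFun h ⟨i - d, by omega⟩

lemma normalCoord_surjective : Function.Surjective (normalCoord n d) := fun w =>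
  ⟨WithLp.toLp 2 fun i => if h : d ≤ i then w ⟨i - d, by omega⟩ else 0, by
    ext j
    simp [normalCoord_apply]⟩

lemma IsSubmanifold.exists_submersion (hM : IsSubmanifold 1 d M) (hp : p ∈ M) :
    ∃ (q : EuclideanSpace ℝ (Fin n) → (Fin (n - d) → ℝ))
      (q' : EuclideanSpace ℝ (Fin n) →L[ℝ] (Fin (n - d) → ℝ)),
      ContDiffAt ℝ 1 q p ∧ HasFDerivAt q q' p ∧ (∀ᶠ x in 𝓝 p, x ∈ M ↔ q x = 0) ∧
      tangentSpace M p = q'.ker ∧ Function.Surjective q' := by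
  obtain ⟨Φ, hpΦ, hΦ, hMΦ⟩ := hM.2 p hp
  obtain ⟨e, he, hes⟩ := hΦ.exists_hasFDerivAt hpΦ
  have hs : Φ.source ∈ 𝓝 p := Φ.open_source.mem_nhds hpΦ
  have hq : HasFDerivAt (fun x => normalCoord n d (Φ x))
      (normalCoord n d ∘L (e : _ →L[ℝ] EuclideanSpace ℝ (Fin n))) p :=
    (normalCoord n d).hasFDerivAt.comp p he
  have hzero : ∀ᶠ x in 𝓝 p, x ∈ M ↔ normalCoord n d (Φ x) = 0 := by
    filter_upwards [hs] with x hx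
    rw [hMΦ x hx, normalCoord_eq_zero_iff]
  refine ⟨_, _, (normalCoord n d).contDiff.contDiffAt.comp p (hΦ.1.contDiffAt hs), hq, hzero,
    (tangentSpace_le_ker hq (hzero.mono fun x hx => hx.1)).antisymm fun w hw => ?_,
    normalCoord_surjective.comp e.surjective⟩
  -- `w` is the velocity of the image under `Φ.symm` of a line in `ℝ^d × {0}`.
  have hline : HasFDerivAt (fun τ : ℝ => Φ p + τ • e w) (.toSpanSingleton ℝ (e w)) 0 :=
    (ContinuousLinearMap.toSpanSingleton ℝ (e w)).hasFDerivAt.const_add _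
  have hcurve : HasFDerivAt (fun τ : ℝ => Φ.symm (Φ p + τ • e w))
      ((e.symm : _ →L[ℝ] EuclideanSpace ℝ (Fin n)) ∘L .toSpanSingleton ℝ (e w)) 0 :=
    HasFDerivAt.comp (0 : ℝ) (by simpa using hes) hline
  have hmem : ∀ᶠ τ : ℝ in 𝓝 0, Φ.symm (Φ p + τ • e w) ∈ M := by
    filter_upwards [hline.continuousAt.eventually_mem
      (Φ.open_target.mem_nhds (by simpa using Φ.map_source hpΦ))] with τ hτ
    rw [hMΦ _ (Φ.map_target hτ), Φ.right_inv hτ, ← normalCoord_eq_zero_iff, map_add, map_smul,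
      normalCoord_eq_zero_iff.2 ((hMΦ p hpΦ).1 hp), show normalCoord n d (e w) = 0 from hw]
    simp
  simpa [Φ.left_inv hpΦ] using fderiv_mem_tangentSpace hcurve hmem 1

lemma IsSubmanifold.finrank_tangentSpace (hM : IsSubmanifold 1 d M) (hp : p ∈ M) :
    Module.finrank ℝ (tangentSpace M p) = d := by
  obtain ⟨q, q', -, -, -, hker, hsurj⟩ := hM.exists_submersion hp
  have hrank := q'.toLinearMap.finrank_range_add_finrank_ker
  rw [LinearMap.range_eq_top.2 hsurj, finrank_top, Module.finrank_fin_fun,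
    finrank_euclideanSpace_fin] at hrank
  have hd := hM.1
  rw [hker]
  change n - d + Module.finrank ℝ q'.ker = n at hrank
  omega

lemma exists_openPartialHomeomorph_contDiffOn {E F : Type*} [NormedAddCommGroup E]
    [NormedSpace ℝ E] [CompleteSpace E] [NormedAddCommGroup F] [NormedSpace ℝ F] {f : E → F}
    {f' : E ≃L[ℝ] F} {a : E} (hf : ContDiffAt ℝ 1 f a) (hf' : HasFDerivAt f (f' : E →L[ℝ] F) a) :
    ∃ φ : OpenPartialHomeomorph E F, a ∈ φ.source ∧ ⇑φ = f ∧
      ContDiffOn ℝ 1 φ φ.source ∧ ContDiffOn ℝ 1 φ.symm φ.target := by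
  have hone : (1 : WithTop ℕ∞) ≠ (⊤ : ℕ∞) := by decide
  let φ := hf.toOpenPartialHomeomorph f hf' one_ne_zero
  exact ⟨φ.restrContDiff ℝ 1 hone, ⟨hf.mem_toOpenPartialHomeomorph_source hf' one_ne_zero, hf,
    hf.to_localInverse hf' one_ne_zero⟩, rfl, φ.contDiffOn_restrContDiff_source ℝ hone,
    φ.contDiffOn_restrContDiff_target ℝ hone⟩

/-- `g : W → Y ∩ U` and the restriction of `f` to `Y ∩ U` are mutually inverse: on the open set
`U`, the set `Y` is a sheet over the open set `W` for the map `f`. -/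
structure IsSheet {E B : Type*} [TopologicalSpace E] [TopologicalSpace B] (Y : Set E) (f : E → B)
    (g : B → E) (U : Set E) (W : Set B) : Prop where
  isOpen_source : IsOpen U
  isOpen_base : IsOpen W
  mapsTo : MapsTo f (Y ∩ U) W
  mapsTo_symm : MapsTo g W (Y ∩ U)
  leftInvOn : LeftInvOn g f (Y ∩ U)
  rightInvOn : RightInvOn g f W

lemma IsSubmanifold.exists_isSheet {F : Type*} [NormedAddCommGroup F] [NormedSpace ℝ F]
    [FiniteDimensional ℝ F] (hF : Module.finrank ℝ F = d) (hM : IsSubmanifold 1 d M) (hp : p ∈ M)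
    {G : EuclideanSpace ℝ (Fin n) → F} {G' : EuclideanSpace ℝ (Fin n) →L[ℝ] F}
    (hG : ContDiffAt ℝ 1 G p) (hG' : HasFDerivAt G G' p)
    (hinj : ∀ w ∈ tangentSpace M p, G' w = 0 → w = 0) :
    ∃ g U W, p ∈ U ∧ IsSheet M G g U W ∧ ContDiffOn ℝ 1 g W := by
  obtain ⟨q, q', hq, hq', hMq, hker, -⟩ := hM.exists_submersion hp
  have hinjective : Function.Injective (G'.prod q').toLinearMap := by
    refine (injective_iff_map_eq_zero _).2 fun w hw => ?_
    exact hinj w (hker.ge (congrArg Prod.snd hw)) (congrArg Prod.fst hw)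
  have hfinrank : Module.finrank ℝ (EuclideanSpace ℝ (Fin n)) =
      Module.finrank ℝ (F × (Fin (n - d) → ℝ)) := by
    have := hM.1
    simp [hF]
    omega
  let e := (LinearEquiv.ofInjectiveOfFinrankEq _ hinjective hfinrank).toContinuousLinearEquiv
  obtain ⟨φ, hpφ, hφ, -, hφs⟩ := exists_openPartialHomeomorph_contDiffOn (f' := e)
    (hG.prodMk hq) (hG'.prodMk hq')
  obtain ⟨V, hV, hVo, hpV⟩ := eventually_nhds_iff.1 hMq
  let ψ := φ.restrOpen V hVo
  have hψ (x) : ψ x = (G x, q x) := congrFun hφ x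
  have htarget : ψ.target ⊆ φ.target := fun z hz => by
    rw [← ψ.right_inv hz]
    exact φ.map_source (ψ.map_target hz).1
  have hright {z : F} (hz : (z, 0) ∈ ψ.target) :
      (G (ψ.symm (z, 0)), q (ψ.symm (z, 0))) = (z, 0) := by
    rw [← hψ, ψ.right_inv hz]
  have hM0 {x} (hx : x ∈ M ∩ ψ.source) : ψ x = (G x, 0) := by
    rw [hψ, (hV x hx.2.2).1 hx.1]
  refine ⟨fun z => ψ.symm (z, 0), ψ.source, {z | (z, 0) ∈ ψ.target}, ⟨hpφ, hpV⟩,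
    ⟨ψ.open_source, ψ.open_target.preimage (by fun_prop), fun x hx => ?_, fun z hz => ?_,
      fun x hx => ?_, fun z hz => congrArg Prod.fst (hright hz)⟩, ?_⟩
  · rw [mem_ofPred_eq, ← hM0 hx]
    exact ψ.map_source hx.2
  · exact ⟨(hV _ (ψ.map_target hz).2).2 (congrArg Prod.snd (hright hz)), ψ.map_target hz⟩
  · rw [← hM0 hx, ψ.left_inv hx.2]
  · exact (hφs.mono htarget).comp (f := fun z : F => (z, (0 : Fin (n - d) → ℝ))) (by fun_prop)
      fun z hz => hz

end Submanifold

section AlmostInverse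

variable {E B : Type*} [NormedAddCommGroup E] [NormedSpace ℝ E] [NormedAddCommGroup B]
  [NormedSpace ℝ B]

lemma eq_top_of_forall_exists_norm_sub_le {F : Submodule ℝ B} (hF : IsClosed (F : Set B)) {r : ℝ}
    (hr : r < 1) (h : ∀ b, ∃ w ∈ F, ‖b - w‖ ≤ r * ‖b‖) : F = ⊤ := by
  by_contra hne
  obtain ⟨b, hb, hbF⟩ := riesz_lemma hF (by simpa [Submodule.eq_top_iff'] using hne)
    (show (r + 1) / 2 < 1 by linarith)
  obtain ⟨w, hw, hwb⟩ := h b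
  have hb0 : 0 < ‖b‖ := norm_pos_iff.2 fun h0 => hb (h0 ▸ F.zero_mem)
  nlinarith [hbF w hw]

variable [FiniteDimensional ℝ E] [FiniteDimensional ℝ B] {T : Submodule ℝ E} {Λ : B →L[ℝ] E}
  {D : E →L[ℝ] B} {c ε : ℝ}

lemma injOn_of_almost_contains_range (hT : Module.finrank ℝ T ≤ Module.finrank ℝ B)
    (hD : ∀ b, D (Λ b) = b) (hc : ‖D‖ ≤ c) (hcε : c * ε ≤ 1 / 2)
    (h : ∀ b, ∃ w ∈ T, ‖w - Λ b‖ ≤ ε * ‖b‖) : ∀ w ∈ T, D w = 0 → w = 0 := by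
  let DT : T →ₗ[ℝ] B := D.toLinearMap ∘ₗ T.subtype
  have hrange : LinearMap.range DT = ⊤ := by
    refine eq_top_of_forall_exists_norm_sub_le (Submodule.closed_of_finiteDimensional _)
      one_half_lt_one fun b => ?_
    obtain ⟨w, hw, hwb⟩ := h b
    refine ⟨D w, ⟨⟨w, hw⟩, rfl⟩, ?_⟩
    calc ‖b - D w‖ = ‖D (w - Λ b)‖ := by rw [map_sub, hD, norm_sub_rev]
      _ ≤ c * (ε * ‖b‖) := D.le_of_opNorm_le_of_le hc hwb
      _ ≤ 1 / 2 * ‖b‖ := by rw [← mul_assoc]; gcongr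
  have hsurj := LinearMap.range_eq_top.1 hrange
  have hinj := (LinearMap.injective_iff_surjective_of_finrank_eq_finrank
    (hT.antisymm (LinearMap.finrank_le_finrank_of_surjective hsurj))).2 hsurj
  exact fun w hw hw0 => congrArg Subtype.val
    ((injective_iff_map_eq_zero DT).1 hinj ⟨w, hw⟩ hw0)

lemma norm_sub_le_of_almost_contains_range (hT : Module.finrank ℝ T ≤ Module.finrank ℝ B)
    (hD : ∀ b, D (Λ b) = b) (hc : ‖D‖ ≤ c) (hε : 0 ≤ ε) (hcε : c * ε ≤ 1 / 2)
    (h : ∀ b, ∃ w ∈ T, ‖w - Λ b‖ ≤ ε * ‖b‖) {S : B →L[ℝ] E} (hS : ∀ b, S b ∈ T)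
    (hDS : ∀ b, D (S b) = b) : ‖S - Λ‖ ≤ ε * (2 + 2 * c * ‖Λ‖) := by
  have hc0 : 0 ≤ c := (norm_nonneg _).trans hc
  have hSD : ∀ w ∈ T, S (D w) = w := fun w hw => sub_eq_zero.1 <|
    injOn_of_almost_contains_range hT hD hc hcε h _ (T.sub_mem (hS _) hw)
      (by rw [map_sub, hDS, sub_self])
  have hsub : ‖S - Λ‖ ≤ ε + ‖S‖ * (c * ε) := by
    refine ContinuousLinearMap.opNorm_le_bound _ (by positivity) fun b => ?_
    obtain ⟨w, hw, hwb⟩ := h b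
    calc ‖(S - Λ) b‖ = ‖(w - Λ b) - S (D (w - Λ b))‖ := by
          rw [map_sub D, hD, map_sub S, hSD w hw, sub_sub_sub_cancel_left]
          rfl
      _ ≤ ε * ‖b‖ + ‖S‖ * (c * (ε * ‖b‖)) := (norm_sub_le _ _).trans <|
          add_le_add hwb (S.le_of_opNorm_le_of_le le_rfl (D.le_of_opNorm_le_of_le hc hwb))
      _ = (ε + ‖S‖ * (c * ε)) * ‖b‖ := by ring
  have hSnorm : ‖S‖ ≤ 2 * (ε + ‖Λ‖) := by
    have := norm_le_norm_sub_add S Λ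
    nlinarith [norm_nonneg S]
  calc ‖S - Λ‖ ≤ ε + 2 * (ε + ‖Λ‖) * (c * ε) := hsub.trans (by gcongr)
    _ = ε * (1 + 2 * (c * ε) + 2 * c * ‖Λ‖) := by ring
    _ ≤ ε * (2 + 2 * c * ‖Λ‖) := by gcongr; linarith

end AlmostInverse

section Covering

variable {E B : Type*} [TopologicalSpace E] [TopologicalSpace B]

lemma isCoveringMap_of_isProperMap [T2Space E] {p : E → B} (hp : IsProperMap p)
    (hloc : IsLocalHomeomorph p) : IsCoveringMap p := by
  rw [isCoveringMap_iff_isCoveringMapOn_univ]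
  refine hp.isClosedMap.isCoveringMapOn_of_isLocalHomeomorphOn (fun z _ => ?_)
    (hloc.isLocalHomeomorphOn.mono (subset_univ _))
  refine (hp.isCompact_preimage isCompact_singleton).finite
    (IsDiscrete.of_openPartialHomeomorph p subset_rfl fun e _ => ?_)
  obtain ⟨φ, hφ, hpφ⟩ := hloc e
  exact ⟨φ, hφ, hpφ.symm⟩

variable {Y : Set E} {f : E → B} {O : Set B}

lemma isProperMap_mapsTo_restrict [T2Space B] [WeaklyLocallyCompactSpace O]
    (hf : ContinuousOn f (Y ∩ f ⁻¹' O))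
    (hproper : ∀ K ⊆ O, IsCompact K → IsCompact (Y ∩ f ⁻¹' K)) :
    IsProperMap (MapsTo.restrict f (Y ∩ f ⁻¹' O) O fun _ hy => hy.2) := by
  refine isProperMap_iff_isCompact_preimage.2 ⟨hf.mapsToRestrict _, fun K hK => ?_⟩
  have hKO : Subtype.val '' K ⊆ O := by
    rintro _ ⟨z, -, rfl⟩
    exact z.2
  rw [Subtype.isCompact_iff]
  convert hproper _ hKO (hK.image continuous_subtype_val) using 1
  ext y
  constructor
  · rintro ⟨⟨y, hy⟩, hyK, rfl⟩
    exact ⟨hy.1, _, hyK, rfl⟩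
  · rintro ⟨hy, z, hzK, hz⟩
    have hyO : f y ∈ O := hz ▸ z.2
    have hpz : MapsTo.restrict f (Y ∩ f ⁻¹' O) O (fun _ hy => hy.2) ⟨y, hy, hyO⟩ = z :=
      Subtype.ext hz.symm
    exact ⟨⟨y, hy, hyO⟩, mem_preimage.2 (hpz ▸ hzK), rfl⟩

lemma isLocalHomeomorph_mapsTo_restrict (hf : ContinuousOn f (Y ∩ f ⁻¹' O))
    (hloc : ∀ y ∈ Y ∩ f ⁻¹' O, ∃ g U W, y ∈ U ∧ IsSheet Y f g U W ∧ ContinuousOn g W) :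
    IsLocalHomeomorph (MapsTo.restrict f (Y ∩ f ⁻¹' O) O fun _ hy => hy.2) := by
  classical
  intro y
  obtain ⟨g, U, W, hyU, h, hg⟩ := hloc y y.2
  have hmem {z : O} (hz : (z : B) ∈ W) : g z ∈ Y ∩ f ⁻¹' O :=
    ⟨(h.mapsTo_symm hz).1, by rw [mem_preimage, h.rightInvOn hz]; exact z.2⟩
  let inv : O → (Y ∩ f ⁻¹' O : Set E) := fun z => if hz : (z : B) ∈ W then ⟨g z, hmem hz⟩ else y
  have hinv {z : O} (hz : (z : B) ∈ W) : (inv z : E) = g z := congrArg Subtype.val (dif_pos hz)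
  refine ⟨{
    toFun := MapsTo.restrict f (Y ∩ f ⁻¹' O) O fun _ hy => hy.2
    invFun := inv
    source := Subtype.val ⁻¹' U
    target := Subtype.val ⁻¹' W
    map_source' := fun x hx => h.mapsTo ⟨x.2.1, hx⟩
    map_target' := fun z hz => mem_preimage.2 ((hinv hz).symm ▸ (h.mapsTo_symm hz).2)
    left_inv' := fun x hx => Subtype.ext <|
      (hinv (h.mapsTo ⟨x.2.1, hx⟩)).trans (h.leftInvOn ⟨x.2.1, hx⟩)
    right_inv' := fun z hz => Subtype.ext <| (congrArg f (hinv hz)).trans (h.rightInvOn hz)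
    open_source := h.isOpen_source.preimage continuous_subtype_val
    open_target := h.isOpen_base.preimage continuous_subtype_val
    continuousOn_toFun := (hf.mapsToRestrict _).continuousOn
    continuousOn_invFun := by
      rw [continuousOn_iff_continuous_domRestrict, continuous_induced_rng]
      exact (hg.comp_continuous (continuous_subtype_val.comp continuous_subtype_val)
        Subtype.prop).congr fun z => (hinv z.2).symm }, hyU, rfl⟩

lemma exists_section_of_proper {E B : Type*} [TopologicalSpace E] [T2Space E]
    [NormedAddCommGroup B] [NormedSpace ℝ B] [FiniteDimensional ℝ B] {Y : Set E} {f : E → B}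
    {O : Set B} (hO : IsOpen O) (hOc : Convex ℝ O) (hf : ContinuousOn f (Y ∩ f ⁻¹' O))
    (hproper : ∀ K ⊆ O, IsCompact K → IsCompact (Y ∩ f ⁻¹' K))
    (hloc : ∀ y ∈ Y ∩ f ⁻¹' O, ∃ g U W, y ∈ U ∧ IsSheet Y f g U W ∧ ContinuousOn g W)
    {y₀ : E} (hy₀ : y₀ ∈ Y ∩ f ⁻¹' O) :
    ∃ s : B → E, ContinuousOn s O ∧ MapsTo s O Y ∧ RightInvOn s f O ∧
      ∀ C ⊆ Y ∩ f ⁻¹' O, IsPreconnected C → y₀ ∈ C → ∀ y ∈ C, s (f y) = y := by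
  have : ProperSpace B := FiniteDimensional.proper ℝ B
  have : LocallyCompactSpace O := hO.locallyCompactSpace
  have : ContractibleSpace O := hOc.contractibleSpace ⟨_, hy₀.2⟩
  have : LocallyPathConnectedSpace O := hO.locallyPathConnectedSpace
  set p := MapsTo.restrict f (Y ∩ f ⁻¹' O) O fun _ hy => hy.2
  have hcov : IsCoveringMap p := isCoveringMap_of_isProperMap
    (isProperMap_mapsTo_restrict hf hproper) (isLocalHomeomorph_mapsTo_restrict hf hloc)
  obtain ⟨F, ⟨hF₀, hF⟩, -⟩ := hcov.existsUnique_continuousMap_lifts (ContinuousMap.id O)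
    ⟨f y₀, hy₀.2⟩ ⟨y₀, hy₀⟩ rfl
  have hpF (z : O) : p (F z) = z := congrFun hF z
  let s : B → E := Function.extend Subtype.val (fun z => ((F z : (Y ∩ f ⁻¹' O : Set E)) : E))
    fun _ => y₀
  have hs (z : O) : s z = F z := Subtype.val_injective.extend_apply _ _ z
  refine ⟨s, ?_, fun z hz => hs ⟨z, hz⟩ ▸ (F ⟨z, hz⟩).2.1,
    fun z hz => hs ⟨z, hz⟩ ▸ congrArg Subtype.val (hpF ⟨z, hz⟩), fun C hC hCc hy₀C y hy => ?_⟩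
  · rw [continuousOn_iff_continuous_domRestrict]
    exact (continuous_subtype_val.comp F.continuous).congr fun z => (hs z).symm
  · have : PreconnectedSpace C := Subtype.preconnectedSpace hCc
    have hlift := hcov.eq_of_comp_eq (A := C) (g₁ := fun c => F (p ⟨c, hC c.2⟩))
      (g₂ := fun c => ⟨c, hC c.2⟩)
      (F.continuous.comp (hcov.continuous.comp (by fun_prop))) (by fun_prop)
      (funext fun c => hpF _) ⟨y₀, hy₀C⟩ hF₀
    exact (hs ⟨f y, (hC hy).2⟩).trans (congrArg Subtype.val (congrFun hlift ⟨y, hy⟩))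

end Covering

section Graph

variable {E A : Type*} [NormedAddCommGroup E] [NormedSpace ℝ E] [NormedAddCommGroup A]
  [NormedSpace ℝ A]

/-- In the open set `U`, the set `X` is the image of the `C^1` section `g`, defined on the open
set `W`, of the linear map `P`. -/
structure IsGraphOn (X : Set E) (P : E →L[ℝ] A) (g : A → E) (U : Set E) (W : Set A) : Prop
    extends IsSheet X P g U W where
  contDiffOn : ContDiffOn ℝ 1 g W

/-- The unit vector pointing from `g (P y)`, the foot of `y`, to `y`; it is `0` if `y` is its own
foot. -/
def direction (P : E →L[ℝ] A) (g : A → E) (y : E) : E :=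
  ‖y - g (P y)‖⁻¹ • (y - g (P y))

/-- The linear map sending `(v, τ)` to the sum of the lift of `v` to the tangent space of the graph
of `g` at the foot of `y` and of `τ` times the direction of `y`. -/
def frame (P : E →L[ℝ] A) (g : A → E) (y : E) : A × ℝ →L[ℝ] E :=
  (fderiv ℝ g (P y)).coprod (.toSpanSingleton ℝ (direction P g y))

lemma frame_apply (P : E →L[ℝ] A) (g : A → E) (y : E) (b : A × ℝ) :
    frame P g y b = fderiv ℝ g (P y) b.1 + b.2 • direction P g y := by
  simp [frame]

lemma norm_smul_direction (P : E →L[ℝ] A) (g : A → E) (y : E) :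
    ‖y - g (P y)‖ • direction P g y = y - g (P y) := by
  rcases eq_or_ne (y - g (P y)) 0 with h | h
  · simp [h]
  · rw [direction, smul_inv_smul₀ (norm_ne_zero_iff.2 h)]

namespace IsGraphOn

variable {X U : Set E} {P : E →L[ℝ] A} {g : A → E} {W : Set A} {a : A}

lemma contDiffAt (h : IsGraphOn X P g U W) (ha : a ∈ W) : ContDiffAt ℝ 1 g a :=
  h.contDiffOn.contDiffAt (h.isOpen_base.mem_nhds ha)

lemma hasFDerivAt (h : IsGraphOn X P g U W) (ha : a ∈ W) : HasFDerivAt g (fderiv ℝ g a) a :=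
  ((h.contDiffAt ha).differentiableAt one_ne_zero).hasFDerivAt

lemma continuousOn_fderiv (h : IsGraphOn X P g U W) : ContinuousOn (fderiv ℝ g) W :=
  h.contDiffOn.continuousOn_fderiv_of_isOpen h.isOpen_base le_rfl

end IsGraphOn

end Graph

section WhitneyB

variable {n : ℕ} {A : Type*} [NormedAddCommGroup A] [NormedSpace ℝ A]

lemma exists_mem_norm_sub_le_of_infDist_lt {E : Type*} [NormedAddCommGroup E] [NormedSpace ℝ E]
    {S : Submodule ℝ E} {η : ℝ} {v : E} (h : Metric.infDist (‖v‖⁻¹ • v) S < η) :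
    ∃ w ∈ S, ‖w - v‖ ≤ η * ‖v‖ := by
  rcases eq_or_ne v 0 with rfl | hv
  · exact ⟨0, S.zero_mem, by simp⟩
  obtain ⟨w, hw, hwη⟩ := (Metric.infDist_lt_iff ⟨0, S.zero_mem⟩).1 h
  refine ⟨‖v‖ • w, S.smul_mem _ hw, ?_⟩
  calc ‖‖v‖ • w - v‖ = ‖‖v‖ • (w - ‖v‖⁻¹ • v)‖ := by
        rw [smul_sub, smul_inv_smul₀ (norm_ne_zero_iff.2 hv)]
    _ = dist (‖v‖⁻¹ • v) w * ‖v‖ := by rw [norm_smul, norm_norm, mul_comm, dist_eq_norm']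
    _ ≤ η * ‖v‖ := by gcongr

lemma exists_mem_norm_sub_le_of_subspaceDist_lt {T S : Submodule ℝ (EuclideanSpace ℝ (Fin n))}
    {η : ℝ} (h : subspaceDist T S < η) {v : EuclideanSpace ℝ (Fin n)} (hv : v ∈ T) :
    ∃ w ∈ S, ‖w - v‖ ≤ η * ‖v‖ := by
  rcases eq_or_ne v 0 with rfl | hv0
  · exact ⟨0, S.zero_mem, by simp⟩
  have hbdd : BddAbove ((fun v => Metric.infDist v (S : Set (EuclideanSpace ℝ (Fin n)))) ''
      {v | v ∈ T ∧ ‖v‖ = 1}) := by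
    refine ⟨1, ?_⟩
    rintro _ ⟨u, ⟨-, hu⟩, rfl⟩
    simpa [hu] using Metric.infDist_le_dist_of_mem (x := u) S.zero_mem
  refine exists_mem_norm_sub_le_of_infDist_lt
    ((le_csSup hbdd ⟨_, ⟨T.smul_mem _ hv, ?_⟩, rfl⟩).trans_lt h)
  exact norm_smul_inv_norm hv0

variable {X Y U : Set (EuclideanSpace ℝ (Fin n))} {x : EuclideanSpace ℝ (Fin n)}
  {π : EuclideanSpace ℝ (Fin n) → EuclideanSpace ℝ (Fin n)}
  {P : EuclideanSpace ℝ (Fin n) →L[ℝ] A} {g : A → EuclideanSpace ℝ (Fin n)} {W : Set A} {ε : ℝ}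

lemma IsNearestPointRetraction.tendsto (h : IsNearestPointRetraction X x π) (hx : x ∈ X) :
    Tendsto π (𝓝 x) (𝓝 x) := by
  rw [tendsto_iff_dist_tendsto_zero]
  have hbound : Tendsto (fun y => 2 * dist y x) (𝓝 x) (𝓝 0) := by
    have : Continuous fun y => 2 * dist y x := by fun_prop
    simpa using this.tendsto x
  refine squeeze_zero' (.of_forall fun y => dist_nonneg) ?_ hbound
  filter_upwards [h] with y hy
  linarith [hy.2 x hx, dist_triangle_left (π y) x y]

lemma IsGraphOn.fderiv_mem_tangentSpace {a : A} (h : IsGraphOn X P g U W) (ha : a ∈ W) (v : A) :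
    fderiv ℝ g a v ∈ tangentSpace X (g a) := by
  refine WhitneyPawlucki.fderiv_mem_tangentSpace (h.hasFDerivAt ha) ?_ v
  filter_upwards [h.isOpen_base.mem_nhds ha] with b hb
  exact (h.mapsTo_symm hb).1

lemma IsGraphOn.eventually_comp_nearestPoint_eq (h : IsGraphOn X P g U W) (hx : x ∈ X ∩ U)
    (hπ : IsNearestPointRetraction X x π) :
    ∀ᶠ y in 𝓝 x, P (π y) ∈ W ∧ g (P (π y)) = π y := by
  filter_upwards [hπ, (hπ.tendsto hx.1).eventually_mem (h.isOpen_source.mem_nhds hx.2)]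
    with y hy hyU
  exact ⟨h.mapsTo ⟨hy.1, hyU⟩, h.leftInvOn ⟨hy.1, hyU⟩⟩

/-- The tangent spaces of `X` at `π y` and at the foot `g (P y)` of `y` are close, so the first half
of condition `(b)` also holds for the latter. -/
lemma IsGraphOn.eventually_exists_mem_norm_sub_fderiv_le (h : IsGraphOn X P g U W)
    (hx : x ∈ X ∩ U) (hπ : IsNearestPointRetraction X x π)
    (hα : Tendsto (alpha X Y π) (𝓝[Y] x) (𝓝 0)) (hε : 0 < ε) :
    ∀ᶠ y in 𝓝[Y] x, ∀ v, ∃ w ∈ tangentSpace Y y, ‖w - fderiv ℝ g (P y) v‖ ≤ ε * ‖v‖ := by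
  set K := ‖fderiv ℝ g (P x)‖
  have hK0 : 0 < K + 1 := by positivity
  have hderiv : ContinuousAt (fderiv ℝ g) (P x) :=
    h.continuousOn_fderiv.continuousAt (h.isOpen_base.mem_nhds (h.mapsTo hx))
  have hPx : Tendsto P (𝓝[Y] x) (𝓝 (P x)) :=
    (P.continuous.tendsto x).mono_left nhdsWithin_le_nhds
  have hDπ : Tendsto (fun y => fderiv ℝ g (P (π y))) (𝓝[Y] x) (𝓝 (fderiv ℝ g (P x))) :=
    ((hderiv.tendsto.comp (P.continuous.tendsto x)).comp (hπ.tendsto hx.1)).mono_left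
      nhdsWithin_le_nhds
  have hsub : Tendsto (fun y => fderiv ℝ g (P (π y)) - fderiv ℝ g (P y)) (𝓝[Y] x) (𝓝 0) :=
    sub_self (fderiv ℝ g (P x)) ▸ hDπ.sub (hderiv.tendsto.comp hPx)
  filter_upwards [(h.eventually_comp_nearestPoint_eq hx hπ).filter_mono nhdsWithin_le_nhds,
    hα.eventually_lt_const (show 0 < ε / 2 / (K + 1) by positivity),
    hDπ.norm.eventually_le_const (lt_add_one K),
    hsub.norm.eventually_le_const (show ‖(0 : A →L[ℝ] EuclideanSpace ℝ (Fin n))‖ < ε / 2 by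
      simpa using hε)] with y hgπ hαy hK hyε v
  have hmem := h.fderiv_mem_tangentSpace hgπ.1 v
  rw [hgπ.2] at hmem
  obtain ⟨w, hw, hwv⟩ := exists_mem_norm_sub_le_of_subspaceDist_lt hαy hmem
  refine ⟨w, hw, ?_⟩
  calc ‖w - fderiv ℝ g (P y) v‖
      ≤ ‖w - fderiv ℝ g (P (π y)) v‖ + ‖(fderiv ℝ g (P (π y)) - fderiv ℝ g (P y)) v‖ :=
        norm_sub_le_norm_sub_add_norm_sub _ _ _
    _ ≤ ε / 2 / (K + 1) * ((K + 1) * ‖v‖) + ε / 2 * ‖v‖ := by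
        refine add_le_add (hwv.trans ?_) (ContinuousLinearMap.le_of_opNorm_le _ hyε v)
        gcongr
        exact ContinuousLinearMap.le_of_opNorm_le _ hK v
    _ = ε * ‖v‖ := by field_simp; ring

lemma IsGraphOn.eventually_exists_mem_norm_sub_secant_le (h : IsGraphOn X P g U W)
    (hx : x ∈ X ∩ U) (hπ : IsNearestPointRetraction X x π)
    (hα : Tendsto (alpha X Y π) (𝓝[Y] x) (𝓝 0)) (hε : 0 < ε) :
    ∀ᶠ y in 𝓝[Y] x, ∃ w ∈ tangentSpace Y y, ‖w - (g (P y) - π y)‖ ≤ ε * ‖y - g (P y)‖ := by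
  set η := ε / (3 * (‖P‖ + 1))
  have hη : 0 < η := by positivity
  have hPx : Tendsto P (𝓝[Y] x) (𝓝 (P x)) :=
    (P.continuous.tendsto x).mono_left nhdsWithin_le_nhds
  have hPπ : Tendsto (fun y => P (π y)) (𝓝[Y] x) (𝓝 (P x)) :=
    ((P.continuous.tendsto x).comp (hπ.tendsto hx.1)).mono_left nhdsWithin_le_nhds
  have hderiv : Tendsto (fun y => fderiv ℝ g (P x) - fderiv ℝ g (P y)) (𝓝[Y] x) (𝓝 0) :=
    sub_self (fderiv ℝ g (P x)) ▸ tendsto_const_nhds.sub ((h.continuousOn_fderiv.continuousAt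
      (h.isOpen_base.mem_nhds (h.mapsTo hx))).tendsto.comp hPx)
  have hstrict : ∀ᶠ z : A × A in 𝓝 (P x, P x),
      ‖g z.1 - g z.2 - fderiv ℝ g (P x) (z.1 - z.2)‖ ≤ η * ‖z.1 - z.2‖ :=
    ((h.contDiffAt (h.mapsTo hx)).hasStrictFDerivAt one_ne_zero).isLittleO.def hη
  filter_upwards [h.eventually_exists_mem_norm_sub_fderiv_le hx hπ hα hη,
    hπ.filter_mono nhdsWithin_le_nhds, (hPx.prodMk_nhds hPπ).eventually hstrict,
    hderiv.norm.eventually_le_const (show ‖(0 : A →L[ℝ] EuclideanSpace ℝ (Fin n))‖ < η by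
      simpa using hη), hPx.eventually_mem (h.isOpen_base.mem_nhds (h.mapsTo hx)),
    (h.eventually_comp_nearestPoint_eq hx hπ).filter_mono nhdsWithin_le_nhds]
    with y hlift hy hyst hyη hyW hgπ
  obtain ⟨w, hw, hwv⟩ := hlift (P y - P (π y))
  refine ⟨w, hw, ?_⟩
  have hfoot : ‖P y - P (π y)‖ ≤ ‖P‖ * ‖y - g (P y)‖ := by
    rw [← map_sub]
    refine P.le_of_opNorm_le_of_le le_rfl ?_
    simpa [dist_eq_norm] using hy.2 _ (h.mapsTo_symm hyW).1
  calc ‖w - (g (P y) - π y)‖ = ‖(w - fderiv ℝ g (P y) (P y - P (π y)))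
        - (fderiv ℝ g (P x) - fderiv ℝ g (P y)) (P y - P (π y))
        - (g (P y) - g (P (π y)) - fderiv ℝ g (P x) (P y - P (π y)))‖ := by
        rw [hgπ.2, _root_.sub_apply]
        congr 1
        abel
    _ ≤ η * ‖P y - P (π y)‖ + η * ‖P y - P (π y)‖ + η * ‖P y - P (π y)‖ :=
        (norm_sub_le _ _).trans (add_le_add ((norm_sub_le _ _).trans
          (add_le_add hwv (ContinuousLinearMap.le_of_opNorm_le _ hyη _))) hyst)
    _ ≤ 3 * η * ((‖P‖ + 1) * ‖y - g (P y)‖) := by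
        nlinarith [norm_nonneg (y - g (P y))]
    _ = ε * ‖y - g (P y)‖ := by simp only [η]; field_simp

lemma IsGraphOn.eventually_exists_mem_norm_sub_direction_le (h : IsGraphOn X P g U W)
    (hx : x ∈ X ∩ U) (hπ : IsNearestPointRetraction X x π)
    (hα : Tendsto (alpha X Y π) (𝓝[Y] x) (𝓝 0)) (hβ : Tendsto (beta Y π) (𝓝[Y] x) (𝓝 0))
    (hε : 0 < ε) : ∀ᶠ y in 𝓝[Y] x, ∃ w ∈ tangentSpace Y y, ‖w - direction P g y‖ ≤ ε := by
  filter_upwards [h.eventually_exists_mem_norm_sub_secant_le hx hπ hα (half_pos hε),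
    hβ.eventually_lt_const (half_pos hε), hπ.filter_mono nhdsWithin_le_nhds,
    (P.continuous.continuousAt.eventually_mem
      (h.isOpen_base.mem_nhds (h.mapsTo hx))).filter_mono nhdsWithin_le_nhds]
    with y ⟨w₁, hw₁, hw₁y⟩ hβy hy hyW
  obtain ⟨w₂, hw₂, hw₂y⟩ := exists_mem_norm_sub_le_of_infDist_lt hβy
  have hnearest : ‖π y - y‖ ≤ ‖y - g (P y)‖ := by
    simpa [dist_eq_norm, norm_sub_rev] using hy.2 _ (h.mapsTo_symm hyW).1
  set r := ‖y - g (P y)‖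
  refine ⟨r⁻¹ • (-w₂ - w₁),
    Submodule.smul_mem _ _ (Submodule.sub_mem _ (Submodule.neg_mem _ hw₂) hw₁), ?_⟩
  calc ‖r⁻¹ • (-w₂ - w₁) - direction P g y‖
      = ‖-(r⁻¹ • ((w₂ - (π y - y)) + (w₁ - (g (P y) - π y))))‖ := by
        rw [direction]
        congr 1
        module
    _ ≤ r⁻¹ * (ε / 2 * ‖π y - y‖ + ε / 2 * r) := by
        rw [norm_neg, norm_smul, norm_inv, norm_norm]
        gcongr
        exact norm_add_le_of_le hw₂y hw₁y
    _ ≤ r⁻¹ * (ε / 2 * r + ε / 2 * r) := by gcongr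
    _ = ε * (r⁻¹ * r) := by ring
    _ ≤ ε := mul_le_of_le_one_right hε.le inv_mul_le_one

lemma IsGraphOn.eventually_exists_mem_norm_sub_frame_le (h : IsGraphOn X P g U W)
    (hx : x ∈ X ∩ U) (hb : WhitneyBAt Y X x) (hε : 0 < ε) :
    ∀ᶠ y in 𝓝[Y] x, ∀ b, ∃ w ∈ tangentSpace Y y, ‖w - frame P g y b‖ ≤ ε * ‖b‖ := by
  obtain ⟨π, hπ, hα, hβ⟩ := hb
  filter_upwards [h.eventually_exists_mem_norm_sub_fderiv_le hx hπ hα (half_pos hε),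
    h.eventually_exists_mem_norm_sub_direction_le hx hπ hα hβ (half_pos hε)]
    with y hlift ⟨u, hu, huy⟩ b
  obtain ⟨w, hw, hwb⟩ := hlift b.1
  refine ⟨w + b.2 • u, Submodule.add_mem _ hw (Submodule.smul_mem _ _ hu), ?_⟩
  calc ‖w + b.2 • u - frame P g y b‖
      = ‖(w - fderiv ℝ g (P y) b.1) + b.2 • (u - direction P g y)‖ := by
        rw [frame_apply]
        congr 1
        module
    _ ≤ ε / 2 * ‖b.1‖ + ‖b.2‖ * (ε / 2) := by
        refine norm_add_le_of_le hwb ?_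
        rw [norm_smul]
        gcongr
    _ ≤ ε / 2 * ‖b‖ + ‖b‖ * (ε / 2) := by
        gcongr
        exacts [norm_fst_le b, norm_snd_le b]
    _ = ε * ‖b‖ := by ring

end WhitneyB

section FootHeight

variable {E A : Type*} [NormedAddCommGroup E] [NormedSpace ℝ E] [NormedAddCommGroup A]
  [NormedSpace ℝ A]

/-- The coordinates of `y` along the graph of `g`: the image under `P` and the distance to the foot
`g (P y)`. -/
def footHeight (P : E →L[ℝ] A) (g : A → E) (y : E) : A × ℝ :=
  (P y, ‖y - g (P y)‖)

lemma norm_direction_le_one (P : E →L[ℝ] A) (g : A → E) (y : E) : ‖direction P g y‖ ≤ 1 := by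
  rw [direction, norm_smul, norm_inv, norm_norm]
  exact inv_mul_le_one

lemma norm_frame_le (P : E →L[ℝ] A) (g : A → E) (y : E) :
    ‖frame P g y‖ ≤ ‖fderiv ℝ g (P y)‖ + 1 := by
  refine ContinuousLinearMap.opNorm_le_bound _ (by positivity) fun b => ?_
  rw [frame_apply, add_mul]
  refine norm_add_le_of_le (ContinuousLinearMap.le_of_opNorm_le_of_le _ le_rfl (norm_fst_le b)) ?_
  rw [norm_smul, mul_comm]
  exact mul_le_mul (norm_direction_le_one P g y) (norm_snd_le b) (norm_nonneg _) zero_le_one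

variable {X U : Set E} {P : E →L[ℝ] A} {g : A → E} {W : Set A} {x y : E}

lemma IsGraphOn.map_fderiv (h : IsGraphOn X P g U W) {a : A} (ha : a ∈ W) (v : A) :
    P (fderiv ℝ g a v) = v := by
  have hid : HasFDerivAt (fun b => P (g b)) (.id ℝ A) a :=
    (hasFDerivAt_id a).congr_of_eventuallyEq
      (eventually_of_mem (h.isOpen_base.mem_nhds ha) fun _ hb => h.rightInvOn hb)
  exact congrArg (fun f : A →L[ℝ] A => f v)
    ((P.hasFDerivAt.comp a (h.hasFDerivAt ha)).unique hid)

lemma IsGraphOn.map_direction (h : IsGraphOn X P g U W) (hy : P y ∈ W) :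
    P (direction P g y) = 0 := by
  rw [direction, map_smul, map_sub, h.rightInvOn hy, sub_self, smul_zero]

lemma IsGraphOn.continuousOn_footHeight (h : IsGraphOn X P g U W) :
    ContinuousOn (footHeight P g) (P ⁻¹' W) :=
  P.continuous.continuousOn.prodMk (continuousOn_id.sub
    (h.contDiffOn.continuousOn.comp P.continuous.continuousOn fun _ hy => hy)).norm

lemma IsGraphOn.ne_foot {Y : Set E} (h : IsGraphOn X P g U W) (hdisj : Disjoint X Y) (hyY : y ∈ Y)
    (hy : P y ∈ W) : y ≠ g (P y) :=
  fun e => hdisj.ne_of_mem (h.mapsTo_symm hy).1 hyY e.symm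

lemma IsGraphOn.comap_footHeight_nhds (h : IsGraphOn X P g U W) (hx : x ∈ X ∩ U) :
    comap (footHeight P g) (𝓝 (P x, 0)) = 𝓝 x := by
  have hPx : P x ∈ W := h.mapsTo hx
  refine le_antisymm ?_ (tendsto_iff_comap.1 ?_)
  · have hfoot : Tendsto (footHeight P g) (comap (footHeight P g) (𝓝 (P x, 0))) (𝓝 (P x, 0)) :=
      tendsto_comap
    have hg : Tendsto (fun y => g (P y)) (comap (footHeight P g) (𝓝 (P x, 0))) (𝓝 x) := by
      have := (h.contDiffAt hPx).continuousAt.tendsto.comp hfoot.fst_nhds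
      rwa [h.leftInvOn hx] at this
    rw [← tendsto_id']
    simpa [Function.id_def] using hg.add (tendsto_zero_iff_norm_tendsto_zero.2 hfoot.snd_nhds)
  · have hc := h.continuousOn_footHeight.continuousAt
      ((h.isOpen_base.preimage P.continuous).mem_nhds hPx)
    simpa [ContinuousAt, footHeight, h.leftInvOn hx] using hc

end FootHeight

section FootHeightDeriv

variable {E A : Type*} [NormedAddCommGroup E] [InnerProductSpace ℝ E] [NormedAddCommGroup A]
  [NormedSpace ℝ A] {X U : Set E} {P : E →L[ℝ] A} {g : A → E} {W : Set A} {y : E}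

lemma IsGraphOn.contDiffAt_footHeight (h : IsGraphOn X P g U W) (hy : P y ∈ W)
    (hne : y ≠ g (P y)) : ContDiffAt ℝ 1 (footHeight P g) y :=
  P.contDiff.contDiffAt.prodMk <|
    (contDiffAt_id.sub ((h.contDiffAt hy).comp y P.contDiff.contDiffAt)).norm ℝ (sub_ne_zero.2 hne)

lemma IsGraphOn.exists_hasFDerivAt_footHeight (h : IsGraphOn X P g U W) (hy : P y ∈ W)
    (hne : y ≠ g (P y)) :
    ∃ D : E →L[ℝ] A × ℝ, HasFDerivAt (footHeight P g) D y ∧ (∀ b, D (frame P g y b) = b) ∧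
      ‖D‖ ≤ ‖P‖ + (1 + ‖fderiv ℝ g (P y)‖ * ‖P‖) := by
  have hsub : y - g (P y) ≠ 0 := sub_ne_zero.2 hne
  have hnorm : DifferentiableAt ℝ (norm : E → ℝ) (y - g (P y)) := differentiableAt_id.norm ℝ hsub
  set N := fderiv ℝ (norm : E → ℝ) (y - g (P y))
  set R := .id ℝ E - fderiv ℝ g (P y) ∘L P
  have hR : HasFDerivAt (fun y => y - g (P y)) R y :=
    (hasFDerivAt_id y).sub ((h.hasFDerivAt hy).comp y P.hasFDerivAt)
  have hPf (b : A × ℝ) : P (frame P g y b) = b.1 := by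
    simp [frame_apply, h.map_fderiv hy, h.map_direction hy]
  have hRf (b : A × ℝ) : R (frame P g y b) = b.2 • direction P g y := by
    simp only [R, _root_.sub_apply, ContinuousLinearMap.comp_apply, hPf]
    simp [frame_apply]
  refine ⟨P.prod (N ∘L R), P.hasFDerivAt.prodMk (hnorm.hasFDerivAt.comp y hR), fun b =>
    Prod.ext (hPf b) ?_, ?_⟩
  · change N (R (frame P g y b)) = b.2
    rw [hRf, direction, map_smul, map_smul, hnorm.fderiv_norm_self]
    simp [hsub]
  · have hN : ‖N‖ ≤ 1 := by
      simpa using norm_fderiv_le_of_lipschitz ℝ (x₀ := y - g (P y)) lipschitzWith_one_norm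
    have hRnorm : ‖R‖ ≤ 1 + ‖fderiv ℝ g (P y)‖ * ‖P‖ := (norm_sub_le _ _).trans <|
      add_le_add ContinuousLinearMap.norm_id_le (ContinuousLinearMap.opNorm_comp_le _ _)
    rw [ContinuousLinearMap.opNorm_prod, Prod.norm_def]
    refine (max_le_add_of_nonneg (norm_nonneg _) (norm_nonneg _)).trans (add_le_add_right ?_ _)
    exact (N.opNorm_comp_le R).trans
      ((mul_le_of_le_one_left (norm_nonneg _) hN).trans hRnorm)

lemma IsGraphOn.exists_forall_frame_bound (h : IsGraphOn X P g U W) {K : Set A} (hK : IsCompact K)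
    (hKW : K ⊆ W) :
    ∃ C > 0, ∀ y, P y ∈ K → y ≠ g (P y) → ‖frame P g y‖ ≤ C ∧
      ∃ D : E →L[ℝ] A × ℝ, HasFDerivAt (footHeight P g) D y ∧ (∀ b, D (frame P g y b) = b) ∧
        ‖D‖ ≤ C := by
  obtain ⟨C, hC⟩ := hK.exists_bound_of_continuousOn (h.continuousOn_fderiv.mono hKW)
  refine ⟨max C 0 + 1 + (‖P‖ + max C 0 * ‖P‖), by positivity, fun y hyK hne => ?_⟩
  have hCy : ‖fderiv ℝ g (P y)‖ ≤ max C 0 := (hC _ hyK).trans (le_max_left _ _)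
  obtain ⟨D, hD, hDframe, hDnorm⟩ := h.exists_hasFDerivAt_footHeight (hKW hyK) hne
  refine ⟨(norm_frame_le P g y).trans ?_, D, hD, hDframe, hDnorm.trans ?_⟩
  · have : 0 ≤ ‖P‖ + max C 0 * ‖P‖ := by positivity
    linarith
  · have : ‖fderiv ℝ g (P y)‖ * ‖P‖ ≤ max C 0 * ‖P‖ := by gcongr
    linarith [le_max_right C 0]

end FootHeightDeriv

section TubeSection

variable {n d : ℕ} {A : Type*} [NormedAddCommGroup A] [NormedSpace ℝ A]
  {X Y U : Set (EuclideanSpace ℝ (Fin n))} {P : EuclideanSpace ℝ (Fin n) →L[ℝ] A}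
  {g : A → EuclideanSpace ℝ (Fin n)} {W : Set A} {x : EuclideanSpace ℝ (Fin n)}

/-- `s` is a `C^1` section over `S × (0, δ)`, with values in `Y`, of the map `footHeight P g`. -/
structure IsTubeSection (Y : Set (EuclideanSpace ℝ (Fin n))) (P : EuclideanSpace ℝ (Fin n) →L[ℝ] A)
    (g : A → EuclideanSpace ℝ (Fin n)) (S : Set A) (δ : ℝ)
    (s : A × ℝ → EuclideanSpace ℝ (Fin n)) : Prop where
  isOpen_base : IsOpen S
  height_pos : 0 < δ
  contDiffOn : ContDiffOn ℝ 1 s (S ×ˢ Ioo 0 δ)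
  mapsTo : MapsTo s (S ×ˢ Ioo 0 δ) Y
  rightInvOn : RightInvOn s (footHeight P g) (S ×ˢ Ioo 0 δ)

lemma IsGraphOn.exists_uniform_frame_approx (h : IsGraphOn X P g U W)
    (hb : ∀ x ∈ X, WhitneyBAt Y X x) {K : Set A} (hK : IsCompact K) (hKW : K ⊆ W) {ε : ℝ}
    (hε : 0 < ε) :
    ∃ δ > 0, ∀ y ∈ Y, P y ∈ K → ‖y - g (P y)‖ < δ →
      ∀ b, ∃ w ∈ tangentSpace Y y, ‖w - frame P g y b‖ ≤ ε * ‖b‖ := by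
  have hsub : g '' K ⊆
      interior {y | y ∈ Y → ∀ b, ∃ w ∈ tangentSpace Y y, ‖w - frame P g y b‖ ≤ ε * ‖b‖} := by
    rintro _ ⟨a, ha, rfl⟩
    have hga := h.mapsTo_symm (hKW ha)
    exact mem_interior_iff_mem_nhds.2 <| mem_nhdsWithin_iff_eventually.1 <|
      h.eventually_exists_mem_norm_sub_frame_le hga (hb _ hga.1) hε
  obtain ⟨δ, hδ, hδK⟩ := (hK.image_of_continuousOn (h.contDiffOn.continuousOn.mono
    hKW)).exists_thickening_subset_open isOpen_interior hsub
  refine ⟨δ, hδ, fun y hy hyK hyδ => interior_subset (hδK ?_) hy⟩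
  exact Metric.mem_thickening_iff.2 ⟨_, mem_image_of_mem g hyK, by rwa [dist_eq_norm]⟩

/-- Near `x`, only the part of `X ∪ Y` away from `X` is seen by `footHeight P g` at positive
heights, and `X ∪ Y` is locally closed. -/
lemma IsGraphOn.exists_forall_isCompact_inter_preimage [ProperSpace A] (h : IsGraphOn X P g U W)
    (hlc : IsLocallyClosed (X ∪ Y)) (hx : x ∈ X ∩ U) :
    ∃ r > 0, ∃ δ > 0, Metric.closedBall (P x) r ⊆ W ∧
      ∀ K ⊆ Metric.closedBall (P x) r ×ˢ Ioo 0 δ, IsCompact K →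
        IsCompact (Y ∩ footHeight P g ⁻¹' K) := by
  obtain ⟨V, Z, hV, hZ, hVZ⟩ := hlc
  have hxV : x ∈ V := ((Set.ext_iff.1 hVZ x).1 (Or.inl hx.1)).1
  have hnhds : (U ∩ V) ∩ Metric.ball x 1 ∈ comap (footHeight P g) (𝓝 (P x, 0)) := by
    rw [h.comap_footHeight_nhds hx]
    exact inter_mem (inter_mem (h.isOpen_source.mem_nhds hx.2) (hV.mem_nhds hxV))
      (Metric.ball_mem_nhds x one_pos)
  obtain ⟨N, hN, hNsub⟩ := hnhds
  obtain ⟨ρ, hρ, hρW⟩ := Metric.nhds_basis_closedBall.mem_iff.1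
    (h.isOpen_base.mem_nhds (h.mapsTo hx))
  obtain ⟨δ, hδ, hδN⟩ := Metric.nhds_basis_closedBall.mem_iff.1 hN
  refine ⟨min ρ δ, lt_min hρ hδ, δ, hδ,
    (Metric.closedBall_subset_closedBall (min_le_left _ _)).trans hρW, fun K hK hKc => ?_⟩
  have hW {y} (hy : footHeight P g y ∈ K) : P y ∈ Metric.closedBall (P x) ρ :=
    Metric.closedBall_subset_closedBall (min_le_left _ _) (hK hy).1
  have htube {y} (hy : footHeight P g y ∈ K) : y ∈ (U ∩ V) ∩ Metric.ball x 1 := by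
    refine hNsub (hδN ?_)
    rw [← closedBall_prod_same]
    refine ⟨Metric.closedBall_subset_closedBall (min_le_right _ _) (hK hy).1, ?_⟩
    rw [Real.closedBall_eq_Icc]
    exact ⟨by linarith [(hK hy).2.1], by linarith [(hK hy).2.2]⟩
  have hYZ : Y ∩ footHeight P g ⁻¹' K =
      Z ∩ (P ⁻¹' Metric.closedBall (P x) ρ ∩ footHeight P g ⁻¹' K) := by
    ext y
    refine ⟨fun ⟨hyY, hyK⟩ => ⟨((Set.ext_iff.1 hVZ y).1 (Or.inr hyY)).2, hW hyK, hyK⟩,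
      fun ⟨hyZ, _, hyK⟩ => ⟨?_, hyK⟩⟩
    refine ((Set.ext_iff.1 hVZ y).2 ⟨(htube hyK).1.2, hyZ⟩).resolve_left fun hyX => ?_
    have hheight : 0 < ‖y - g (P y)‖ := (hK hyK).2.1
    rw [h.leftInvOn ⟨hyX, (htube hyK).1.1⟩, sub_self, norm_zero] at hheight
    exact hheight.false
  refine Metric.isCompact_of_isClosed_isBounded ?_
    ((Metric.isBounded_ball (x := x) (r := 1)).subset fun y hy => (htube hy.2).2)
  rw [hYZ]
  exact hZ.inter ((h.continuousOn_footHeight.mono (preimage_mono hρW)).preimage_isClosed_of_isClosed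
    (Metric.isClosed_closedBall.preimage P.continuous) hKc.isClosed)

lemma IsSheet.eventuallyEq {E B : Type*} [TopologicalSpace E] [TopologicalSpace B] {Y : Set E}
    {f : E → B} {g s : B → E} {U : Set E} {W : Set B} {z : B} (h : IsSheet Y f g U W)
    (hs : ContinuousAt s z) (hsz : s z ∈ U) (hsY : ∀ᶠ w in 𝓝 z, s w ∈ Y ∧ f (s w) = w) :
    s =ᶠ[𝓝 z] g := by
  filter_upwards [hs.eventually_mem (h.isOpen_source.mem_nhds hsz), hsY] with w hw hwY
  rw [← h.leftInvOn ⟨hwY.1, hw⟩, hwY.2]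

lemma IsTubeSection.hasFDerivAt {S : Set A} {δ : ℝ}
    {s : A × ℝ → EuclideanSpace ℝ (Fin n)} {z : A × ℝ}
    (hs : IsTubeSection Y P g S δ s) (hz : z ∈ S ×ˢ Ioo 0 δ) : HasFDerivAt s (fderiv ℝ s z) z :=
  ((hs.contDiffOn.contDiffAt ((hs.isOpen_base.prod isOpen_Ioo).mem_nhds hz)).differentiableAt
    one_ne_zero).hasFDerivAt

lemma IsTubeSection.map_eq {S : Set A} {δ : ℝ} {s : A × ℝ → EuclideanSpace ℝ (Fin n)} {z : A × ℝ}
    (hs : IsTubeSection Y P g S δ s) (hz : z ∈ S ×ˢ Ioo 0 δ) : P (s z) = z.1 :=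
  congrArg Prod.fst (hs.rightInvOn hz)

lemma IsTubeSection.norm_sub_foot {S : Set A} {δ : ℝ} {s : A × ℝ → EuclideanSpace ℝ (Fin n)}
    {z : A × ℝ} (hs : IsTubeSection Y P g S δ s) (hz : z ∈ S ×ˢ Ioo 0 δ) :
    ‖s z - g (P (s z))‖ = z.2 :=
  congrArg Prod.snd (hs.rightInvOn hz)

lemma IsTubeSection.direction_eq {S : Set A} {δ : ℝ} {s : A × ℝ → EuclideanSpace ℝ (Fin n)}
    {z : A × ℝ} (hs : IsTubeSection Y P g S δ s) (hz : z ∈ S ×ˢ Ioo 0 δ) :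
    direction P g (s z) = z.2⁻¹ • (s z - g z.1) := by
  rw [direction, hs.norm_sub_foot hz, hs.map_eq hz]

variable [FiniteDimensional ℝ A]

lemma IsGraphOn.exists_forall_isSheet (h : IsGraphOn X P g U W) (hA : Module.finrank ℝ A = d)
    (hY : IsSubmanifold 1 (d + 1) Y) (hdisj : Disjoint X Y) (hb : ∀ x ∈ X, WhitneyBAt Y X x)
    {K : Set A} (hK : IsCompact K) (hKW : K ⊆ W) :
    ∃ δ > 0, ∀ y ∈ Y, P y ∈ K → ‖y - g (P y)‖ < δ →
      ∃ s V O, y ∈ V ∧ IsSheet Y (footHeight P g) s V O ∧ ContDiffOn ℝ 1 s O := by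
  have hfinrank : Module.finrank ℝ (A × ℝ) = d + 1 := by simp [hA]
  obtain ⟨C, hC, hbound⟩ := h.exists_forall_frame_bound hK hKW
  obtain ⟨δ, hδ, happrox⟩ := h.exists_uniform_frame_approx hb hK hKW
    (show 0 < 1 / 2 / C by positivity)
  refine ⟨δ, hδ, fun y hy hyK hyδ => ?_⟩
  have hne : y ≠ g (P y) := h.ne_foot hdisj hy (hKW hyK)
  obtain ⟨-, D, hD, hDframe, hDC⟩ := hbound y hyK hne
  exact hY.exists_isSheet hfinrank hy (h.contDiffAt_footHeight (hKW hyK) hne) hD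
    (injOn_of_almost_contains_range ((hY.finrank_tangentSpace hy).trans hfinrank.symm).le
      hDframe hDC (mul_div_cancel₀ _ hC.ne').le (happrox y hy hyK hyδ))

/-- The derivative of a section takes its values in the tangent spaces of `Y`, which almost contain
the frame, and both are right inverse to the derivative of `footHeight P g`. -/
lemma IsTubeSection.tendstoUniformlyOn_fderiv_sub_frame {S : Set A} {δ : ℝ}
    {s : A × ℝ → EuclideanSpace ℝ (Fin n)} (hs : IsTubeSection Y P g S δ s)
    (h : IsGraphOn X P g U W) (hA : Module.finrank ℝ A = d) (hY : IsSubmanifold 1 (d + 1) Y)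
    (hdisj : Disjoint X Y) (hb : ∀ x ∈ X, WhitneyBAt Y X x) {K : Set A} (hK : IsCompact K)
    (hKW : K ⊆ W) (hSK : S ⊆ K) :
    TendstoUniformlyOn (fun t a => fderiv ℝ s (a, t) - frame P g (s (a, t))) 0 (𝓝[>] 0) S := by
  refine Metric.tendstoUniformlyOn_iff.2 fun ε hε => ?_
  obtain ⟨C, hC, hbound⟩ := h.exists_forall_frame_bound hK hKW
  set η := min (1 / 2 / C) (ε / 2 / (2 + 2 * C * C))
  have hη : 0 < η := by positivity
  obtain ⟨δ', hδ', happrox⟩ := h.exists_uniform_frame_approx hb hK hKW hη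
  filter_upwards [Ioo_mem_nhdsGT hδ', Ioo_mem_nhdsGT hs.height_pos] with t ht' ht a ha
  have hz : (a, t) ∈ S ×ˢ Ioo 0 δ := ⟨ha, ht⟩
  have hPs : P (s (a, t)) ∈ K := (hs.map_eq hz).symm ▸ hSK ha
  obtain ⟨hframe, D, hD, hDframe, hDC⟩ := hbound _ hPs
    (h.ne_foot hdisj (hs.mapsTo hz) (hKW hPs))
  have hnhds := (hs.isOpen_base.prod isOpen_Ioo).mem_nhds hz
  have hDs (b : A × ℝ) : D (fderiv ℝ s (a, t) b) = b :=
    congrArg (fun f : A × ℝ →L[ℝ] A × ℝ => f b) <| (hD.comp (a, t) (hs.hasFDerivAt hz)).unique <|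
      (hasFDerivAt_id (a, t)).congr_of_eventuallyEq
        (eventually_of_mem hnhds fun _ hw => hs.rightInvOn hw)
  have hsub := norm_sub_le_of_almost_contains_range
    (show Module.finrank ℝ (tangentSpace Y (s (a, t))) ≤ Module.finrank ℝ (A × ℝ) by
      simp [hY.finrank_tangentSpace (hs.mapsTo hz), hA]) hDframe hDC hη.le
    ((le_div_iff₀' hC).1 (min_le_left _ _)) (happrox _ (hs.mapsTo hz) hPs
      ((hs.norm_sub_foot hz).trans_lt ht'.2))
    (fderiv_mem_tangentSpace (hs.hasFDerivAt hz) (eventually_of_mem hnhds hs.mapsTo)) hDs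
  rw [Pi.zero_apply, dist_zero_left]
  calc ‖fderiv ℝ s (a, t) - frame P g (s (a, t))‖ ≤ η * (2 + 2 * C * ‖frame P g (s (a, t))‖) := hsub
    _ ≤ ε / 2 / (2 + 2 * C * C) * (2 + 2 * C * C) := by
        gcongr
        exact min_le_right _ _
    _ < ε := by
        rw [div_mul_cancel₀ _ (by positivity)]
        exact half_lt_self hε

lemma IsGraphOn.exists_isTubeSection (h : IsGraphOn X P g U W) (hA : Module.finrank ℝ A = d)
    (hY : IsSubmanifold 1 (d + 1) Y) (hdisj : Disjoint X Y) (hlc : IsLocallyClosed (X ∪ Y))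
    (hb : ∀ x ∈ X, WhitneyBAt Y X x) (hx : x ∈ X ∩ U) (hconn : ConnectedNear Y x) :
    ∃ r > 0, ∃ δ s, Metric.closedBall (P x) r ⊆ W ∧
      IsTubeSection Y P g (Metric.ball (P x) r) δ s ∧
      ∀ᶠ y in 𝓝 x, y ∈ Y → s (footHeight P g y) = y := by
  have : ProperSpace A := FiniteDimensional.proper ℝ A
  obtain ⟨r, hr, δ₁, hδ₁, hrW, hproper⟩ := h.exists_forall_isCompact_inter_preimage hlc hx
  obtain ⟨δ₂, hδ₂, hsheet⟩ := h.exists_forall_isSheet hA hY hdisj hb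
    (isCompact_closedBall (P x) r) hrW
  set δ := min δ₁ δ₂
  have hδ : 0 < δ := lt_min hδ₁ hδ₂
  set O := Metric.ball (P x) r ×ˢ Ioo 0 δ
  have hO : IsOpen O := Metric.isOpen_ball.prod isOpen_Ioo
  have hOsub : O ⊆ Metric.closedBall (P x) r ×ˢ Ioo 0 δ₁ :=
    prod_mono Metric.ball_subset_closedBall (Ioo_subset_Ioo_right (min_le_left _ _))
  have hsheetO : ∀ y ∈ Y ∩ footHeight P g ⁻¹' O, ∃ s V O', y ∈ V ∧
      IsSheet Y (footHeight P g) s V O' ∧ ContDiffOn ℝ 1 s O' := fun y hy =>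
    hsheet y hy.1 (hOsub hy.2).1 (hy.2.2.2.trans_le (min_le_right _ _))
  have hnhds : ∀ᶠ y in 𝓝 x, P y ∈ Metric.ball (P x) r ∧ ‖y - g (P y)‖ < δ := by
    rw [← h.comap_footHeight_nhds hx]
    exact tendsto_comap.eventually (prod_mem_nhds (Metric.ball_mem_nhds _ hr) (Iio_mem_nhds hδ))
  obtain ⟨ε₁, hε₁, hball⟩ := Metric.mem_nhds_iff.1 hnhds
  obtain ⟨ε, hconnected, hε⟩ := (hconn.and (Ioo_mem_nhdsGT hε₁)).exists
  have hC : Y ∩ Metric.ball x ε ⊆ Y ∩ footHeight P g ⁻¹' O := fun y hy => by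
    have hyO := hball (Metric.ball_subset_ball hε.2.le hy.2)
    refine ⟨hy.1, hyO.1, norm_pos_iff.2 (sub_ne_zero.2 ?_), hyO.2⟩
    exact h.ne_foot hdisj hy.1 (hrW (Metric.ball_subset_closedBall hyO.1))
  obtain ⟨y₀, hy₀⟩ := hconnected.nonempty
  obtain ⟨s, hs, hsY, hsinv, hsC⟩ := exists_section_of_proper hO
    ((convex_ball _ _).prod (convex_Ioo _ _))
    (h.continuousOn_footHeight.mono fun y hy => hrW (hOsub hy.2).1)
    (fun K hK => hproper K (hK.trans hOsub))
    (fun y hy => let ⟨s, V, O', hyV, hsV, hsd⟩ := hsheetO y hy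
      ⟨s, V, O', hyV, hsV, hsd.continuousOn⟩)
    (hC hy₀)
  refine ⟨r, hr, δ, s, hrW, ⟨Metric.isOpen_ball, hδ, fun z hz => ?_, hsY, hsinv⟩, ?_⟩
  · have hsz : s z ∈ Y ∩ footHeight P g ⁻¹' O := ⟨hsY hz, mem_preimage.2 (by rwa [hsinv hz])⟩
    obtain ⟨s', V, O', hzV, hsV, hsd⟩ := hsheetO (s z) hsz
    have hzO' : z ∈ O' := hsinv hz ▸ hsV.mapsTo ⟨hsz.1, hzV⟩
    refine ((hsd.contDiffAt (hsV.isOpen_base.mem_nhds hzO')).congr_of_eventuallyEq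
      (hsV.eventuallyEq (hs.continuousAt (hO.mem_nhds hz)) hzV ?_)).contDiffWithinAt
    exact eventually_of_mem (hO.mem_nhds hz) fun w hw => ⟨hsY hw, hsinv hw⟩
  · filter_upwards [Metric.ball_mem_nhds x hε.1] with y hyε hy
    exact hsC _ hC hconnected.isPreconnected hy₀ y ⟨hy, hyε⟩

end TubeSection

section DyadicLimit

variable {α F : Type*} [NormedAddCommGroup F] {θ : ℝ}

lemma norm_sub_le_of_dyadic {f : ℝ → F} {τ : ℝ} (hθ : 0 < θ)
    (hf : ∀ t ∈ Ioo 0 τ, ∀ t' ∈ Icc (t / 2) t, ‖f t - f t'‖ ≤ t ^ θ) {t t' : ℝ} (ht' : 0 < t')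
    (htt' : t' ≤ t) (ht : t < τ) : ‖f t - f t'‖ ≤ (1 - (1 / 2) ^ θ)⁻¹ * t ^ θ := by
  set q : ℝ := (1 / 2) ^ θ
  have : 0 ≤ q := by positivity
  have hq : 0 < 1 - q := sub_pos.2 (Real.rpow_lt_one (by norm_num) (by norm_num) hθ)
  have hgeom : 1 + (1 - q)⁻¹ * q = (1 - q)⁻¹ := by
    field_simp
    ring
  obtain ⟨k, hk⟩ := exists_nat_gt (t / t')
  replace hk : t ≤ 2 ^ k * t' :=
    ((div_lt_iff₀ ht').1 hk).le.trans (by gcongr; exact_mod_cast Nat.lt_two_pow_self.le)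
  induction k generalizing t with
  | zero =>
    obtain rfl : t' = t := htt'.antisymm (by simpa using hk)
    simpa using mul_nonneg (inv_nonneg.2 hq.le) (Real.rpow_nonneg ht'.le θ)
  | succ k ih =>
    have htpos : 0 < t := ht'.trans_le htt'
    have htθ : 0 ≤ t ^ θ := Real.rpow_nonneg htpos.le θ
    rcases le_total (t / 2) t' with hhalf | hhalf
    · refine (hf t ⟨htpos, ht⟩ t' ⟨hhalf, htt'⟩).trans (le_mul_of_one_le_left htθ ?_)
      rw [← hgeom]
      exact le_add_of_nonneg_right (by positivity)
    · calc ‖f t - f t'‖ ≤ ‖f t - f (t / 2)‖ + ‖f (t / 2) - f t'‖ :=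
            norm_sub_le_norm_sub_add_norm_sub _ _ _
        _ ≤ t ^ θ + (1 - q)⁻¹ * (t / 2) ^ θ := by
            refine add_le_add (hf t ⟨htpos, ht⟩ _ ⟨le_rfl, half_le_self htpos.le⟩)
              (ih hhalf (by linarith) ?_)
            rw [pow_succ] at hk
            linarith
        _ = (1 + (1 - q)⁻¹ * q) * t ^ θ := by
            rw [div_eq_mul_one_div, Real.mul_rpow htpos.le (by norm_num)]
            ring
        _ = (1 - q)⁻¹ * t ^ θ := by rw [hgeom]

lemma exists_tendstoUniformlyOn_of_dyadic [CompleteSpace F] {D : ℝ → α → F} {S : Set α}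
    (hθ : 0 < θ)
    (hD : ∀ᶠ t in 𝓝[>] 0, ∀ a ∈ S, ∀ t' ∈ Icc (t / 2) t, ‖D t a - D t' a‖ ≤ t ^ θ) :
    ∃ u, TendstoUniformlyOn D u (𝓝[>] 0) S := by
  obtain ⟨τ, hτ, hDτ⟩ := mem_nhdsGT_iff_exists_Ioo_subset.1 hD
  set C : ℝ := (1 - (1 / 2) ^ θ)⁻¹
  have hzero : Tendsto (fun t : ℝ => C * t ^ θ) (𝓝[>] 0) (𝓝 0) := by
    have : ContinuousAt (fun t : ℝ => C * t ^ θ) 0 :=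
      continuousAt_const.mul (Real.continuousAt_rpow_const 0 θ (.inr hθ.le))
    simpa [ContinuousAt, Real.zero_rpow hθ.ne'] using this.tendsto.mono_left nhdsWithin_le_nhds
  have hcauchy : UniformCauchySeqOn D (𝓝[>] 0) S := by
    intro U hU
    obtain ⟨ε, hε, hεU⟩ := Metric.mem_uniformity_dist.1 hU
    have hsmall : ∀ᶠ t in 𝓝[>] (0 : ℝ), t ∈ Ioo 0 τ ∧ C * t ^ θ < ε :=
      Filter.Eventually.and (Ioo_mem_nhdsGT hτ) (hzero.eventually_lt_const hε)
    have hle {t t' : ℝ} (ht : t ∈ Ioo 0 τ ∧ C * t ^ θ < ε) (ht' : 0 < t') (htt' : t' ≤ t) {a : α}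
        (ha : a ∈ S) : dist (D t a) (D t' a) < ε := by
      rw [dist_eq_norm]
      exact (norm_sub_le_of_dyadic (f := (D · a)) hθ (fun t ht => hDτ ht a ha) ht' htt'
        ht.1.2).trans_lt ht.2
    filter_upwards [hsmall.prod_mk hsmall] with ⟨t, t'⟩ ⟨ht, ht'⟩ a ha
    refine hεU ?_
    rcases le_total t' t with htt' | htt'
    · exact hle ht ht'.1.1 htt' ha
    · exact dist_comm (D t a) _ ▸ hle ht' ht.1.1 htt' ha
  choose! u hu using fun a (ha : a ∈ S) => CompleteSpace.complete (hcauchy.cauchy_map ha)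
  exact ⟨u, hcauchy.tendstoUniformlyOn_of_tendsto hu⟩

end DyadicLimit

section FiberDirection

variable {n d : ℕ} {X Y : Set (EuclideanSpace ℝ (Fin n))}
  {P : EuclideanSpace ℝ (Fin n) →L[ℝ] (Fin d → ℝ)} {x : EuclideanSpace ℝ (Fin n)}

/-- The unit vector `u` of the kernel of `P` points from `p` to a point of `Y` at distance `t`. The
norm is squared so that the relation is visibly semialgebraic in `(p, u, t)` and `Y`. -/
def IsFiberDirection (Y : Set (EuclideanSpace ℝ (Fin n)))
    (P : EuclideanSpace ℝ (Fin n) →L[ℝ] (Fin d → ℝ)) (p u : EuclideanSpace ℝ (Fin n)) (t : ℝ) :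
    Prop :=
  ‖u‖ ^ 2 = 1 ∧ P u = 0 ∧ p + t • u ∈ Y

/-- Over some point of `X` within `ρ` of `x` there are two points of `Y`, at comparable distances
`t < ρ` and `t'`, whose directions differ by at least `σ`. -/
def DirectionOscillation (X Y : Set (EuclideanSpace ℝ (Fin n)))
    (P : EuclideanSpace ℝ (Fin n) →L[ℝ] (Fin d → ℝ)) (x : EuclideanSpace ℝ (Fin n))
    (ρ σ t : ℝ) : Prop :=
  0 < t ∧ t < ρ ∧ ∃ p ∈ X, ‖p - x‖ ^ 2 < ρ ^ 2 ∧ ∃ u u' t', t ≤ 2 * t' ∧ t' ≤ t ∧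
    IsFiberDirection Y P p u t ∧ IsFiberDirection Y P p u' t' ∧ σ ^ 2 ≤ ‖u - u'‖ ^ 2

variable {L : Language} [L.Structure ℝ]

lemma IsDefinable.setOf_isFiberDirection {α : Type*} (hL : ExpandsRealField L)
    (hY : IsDefinable L Y) {p u : (α → ℝ) → EuclideanSpace ℝ (Fin n)} {t : (α → ℝ) → ℝ}
    (hp : ∀ i, (univ : Set ℝ).DefinableFun L fun v => p v i)
    (hu : ∀ i, (univ : Set ℝ).DefinableFun L fun v => u v i)
    (ht : (univ : Set ℝ).DefinableFun L t) :
    (univ : Set ℝ).Definable L {v | IsFiberDirection Y P (p v) (u v) (t v)} := by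
  have hker : {v | P (u v) = 0} = ⋂ j, {v | (ContinuousLinearMap.proj j ∘L P) (u v) = 0} := by
    ext v
    simp [funext_iff]
  have hkerdef : (univ : Set ℝ).Definable L {v | P (u v) = 0} := hker ▸
    definable_iInter_of_finite fun j =>
      (hL.definableFun_linear _ hu).ofPred_eq (definableFun_const 0)
  exact ((hL.definableFun_norm_sq hu).ofPred_eq (definableFun_const 1)).inter <| hkerdef.inter <|
    hY.preimage (f := fun v => p v + t v • u v) fun i =>
      hL.definableFun_add (hp i) (hL.definableFun_mul ht (hu i))

lemma definable_directionOscillation (hL : ExpandsRealField L) (hX : IsDefinable L X)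
    (hY : IsDefinable L Y) (P : EuclideanSpace ℝ (Fin n) →L[ℝ] (Fin d → ℝ))
    (x : EuclideanSpace ℝ (Fin n)) (ρ : ℝ) : (univ : Set ℝ).Definable L
      {v : Fin 2 → ℝ | DirectionOscillation X Y P x ρ (v 0) (v 1)} := by
  -- The coordinates are `(σ, t)`, `p`, `u`, `u'` and `t'`.
  let I := Fin 2 ⊕ ((Fin n ⊕ Fin n) ⊕ (Fin n ⊕ Fin 1))
  let p (v : I → ℝ) : EuclideanSpace ℝ (Fin n) := .toLp 2 fun i => v (.inr (.inl (.inl i)))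
  let u (v : I → ℝ) : EuclideanSpace ℝ (Fin n) := .toLp 2 fun i => v (.inr (.inl (.inr i)))
  let u' (v : I → ℝ) : EuclideanSpace ℝ (Fin n) := .toLp 2 fun i => v (.inr (.inr (.inl i)))
  have hproj (i : I) : (univ : Set ℝ).DefinableFun L fun v : I → ℝ => v i := DefinableFun.proj L
  have hp (i : Fin n) : (univ : Set ℝ).DefinableFun L fun v => p v i := hproj _
  have hu (i : Fin n) : (univ : Set ℝ).DefinableFun L fun v => u v i := hproj _
  have hu' (i : Fin n) : (univ : Set ℝ).DefinableFun L fun v => u' v i := hproj _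
  have hσ := hproj (.inl 0)
  have ht := hproj (.inl 1)
  have ht' := hproj (.inr (.inr (.inr 0)))
  have hnear := hL.definable_setOf_lt (hL.definableFun_norm_sq (f := fun v => p v - x) fun i =>
    hL.definableFun_sub (hp i) (definableFun_const (x i))) (definableFun_const (ρ ^ 2))
  have hcomparable := (hL.definable_setOf_le ht (hL.definableFun_mul (definableFun_const 2)
    ht')).inter (hL.definable_setOf_le ht' ht)
  have hfar := hL.definable_setOf_le (hL.definableFun_mul hσ hσ)
    (hL.definableFun_norm_sq (f := fun v => u v - u' v) fun i =>
      hL.definableFun_sub (hu i) (hu' i))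
  have hmatrix := (hX.preimage hp).inter <| hnear.inter <| hcomparable.inter <|
    (hY.setOf_isFiberDirection (P := P) hL hp hu ht).inter <|
      (hY.setOf_isFiberDirection (P := P) hL hp hu' ht').inter hfar
  have hproj₂ : (univ : Set ℝ).DefinableFun L fun v : Fin 2 → ℝ => v 1 := DefinableFun.proj L
  convert ((hL.definable_setOf_lt (definableFun_const 0) hproj₂).inter
    (hL.definable_setOf_lt hproj₂ (definableFun_const ρ))).inter
      (Definable.exists_of_finite (α := Fin 2) hmatrix) using 1
  ext v
  constructor
  · rintro ⟨ht₀, htρ, p, hp, hpρ, u, u', t', h2t, htt', hu, hu', hσ⟩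
    exact ⟨⟨ht₀, htρ⟩, Sum.elim (Sum.elim p u) (Sum.elim u' fun _ => t'), hp, hpρ, ⟨h2t, htt'⟩, hu,
      hu', (sq (v 0)).symm.trans_le hσ⟩
  · rintro ⟨⟨ht₀, htρ⟩, w, hp, hpρ, ⟨h2t, htt'⟩, hu, hu', hσ⟩
    exact ⟨ht₀, htρ, _, hp, hpρ, _, _, _, h2t, htt', hu, hu', (sq (v 0)).trans_le hσ⟩

variable {U : Set (EuclideanSpace ℝ (Fin n))} {g : (Fin d → ℝ) → EuclideanSpace ℝ (Fin n)}
  {W : Set (Fin d → ℝ)}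

lemma IsFiberDirection.norm_eq_one {p u : EuclideanSpace ℝ (Fin n)} {t : ℝ}
    (h : IsFiberDirection Y P p u t) : ‖u‖ = 1 :=
  (pow_eq_one_iff_of_nonneg (norm_nonneg u) two_ne_zero).1 h.1

lemma IsFiberDirection.footHeight_eq {p u : EuclideanSpace ℝ (Fin n)} {t : ℝ}
    (hu : IsFiberDirection Y P p u t) (h : IsGraphOn X P g U W) (hp : p ∈ X ∩ U) (ht : 0 < t) :
    footHeight P g (p + t • u) = (P p, t) := by
  simp [footHeight, hu.2.1, h.leftInvOn hp, norm_smul, hu.norm_eq_one, abs_of_pos ht]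

lemma IsFiberDirection.direction_eq {p u : EuclideanSpace ℝ (Fin n)} {t : ℝ}
    (hu : IsFiberDirection Y P p u t) (h : IsGraphOn X P g U W) (hp : p ∈ X ∩ U) (ht : 0 < t) :
    direction P g (p + t • u) = u := by
  simp [direction, hu.2.1, h.leftInvOn hp, norm_smul, hu.norm_eq_one, abs_of_pos ht, ht.ne',
    smul_smul]

lemma norm_direction {E A : Type*} [NormedAddCommGroup E] [NormedSpace ℝ E] [NormedAddCommGroup A]
    [NormedSpace ℝ A] {P : E →L[ℝ] A} {g : A → E} {y : E} (hy : y ≠ g (P y)) :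
    ‖direction P g y‖ = 1 :=
  norm_smul_inv_norm (sub_ne_zero.2 hy)

lemma IsGraphOn.isFiberDirection {y : EuclideanSpace ℝ (Fin n)} (h : IsGraphOn X P g U W)
    (hyY : y ∈ Y) (hyW : P y ∈ W) (hy : y ≠ g (P y)) :
    IsFiberDirection Y P (g (P y)) (direction P g y) ‖y - g (P y)‖ := by
  refine ⟨by rw [norm_direction hy, one_pow], h.map_direction hyW, ?_⟩
  rwa [norm_smul_direction, add_sub_cancel]

end FiberDirection

section Oscillation

lemma norm_inv_smul_sub_inv_smul_le {E : Type*} [NormedAddCommGroup E] [NormedSpace ℝ E]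
    {c c' : ℝ → E} {t t' ε : ℝ} (ht' : 0 < t') (htt' : t' ≤ t) (h2t : t ≤ 2 * t')
    (hc : ∀ τ ∈ Icc t' t, HasDerivAt c (c' τ) τ)
    (hε : ∀ τ ∈ Icc t' t, ‖c' τ - τ⁻¹ • c τ‖ ≤ ε) : ‖t⁻¹ • c t - t'⁻¹ • c t'‖ ≤ ε := by
  have hderiv : ∀ τ ∈ Icc t' t, HasDerivWithinAt (fun τ => τ⁻¹ • c τ)
      (τ⁻¹ • (c' τ - τ⁻¹ • c τ)) (Icc t' t) τ := fun τ hτ => by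
    refine (((hasDerivAt_inv (ht'.trans_le hτ.1).ne').smul (hc τ hτ)).congr_deriv
      ?_).hasDerivWithinAt
    rw [sq, mul_inv]
    module
  have hbound : ∀ τ ∈ Icc t' t, ‖τ⁻¹ • (c' τ - τ⁻¹ • c τ)‖ ≤ t'⁻¹ * ε := fun τ hτ => by
    rw [norm_smul, norm_inv, Real.norm_of_nonneg (ht'.trans_le hτ.1).le]
    exact mul_le_mul (inv_anti₀ ht' hτ.1) (hε τ hτ) (norm_nonneg _) (inv_nonneg.2 ht'.le)
  calc ‖t⁻¹ • c t - t'⁻¹ • c t'‖ ≤ t'⁻¹ * ε * ‖t - t'‖ :=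
        (convex_Icc t' t).norm_image_sub_le_of_norm_hasDerivWithin_le hderiv hbound
          (left_mem_Icc.2 htt') (right_mem_Icc.2 htt')
    _ = t'⁻¹ * (t - t') * ε := by rw [Real.norm_of_nonneg (sub_nonneg.2 htt')]; ring
    _ ≤ ε := mul_le_of_le_one_left
        ((norm_nonneg _).trans (hε t (right_mem_Icc.2 htt')))
        ((inv_mul_le_iff₀ ht').2 (by linarith))

lemma IsTubeSection.eventually_norm_direction_sub_le {n : ℕ} {A : Type*} [NormedAddCommGroup A]
    [NormedSpace ℝ A] {Y : Set (EuclideanSpace ℝ (Fin n))} {P : EuclideanSpace ℝ (Fin n) →L[ℝ] A}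
    {g : A → EuclideanSpace ℝ (Fin n)} {S : Set A} {δ ε : ℝ}
    {s : A × ℝ → EuclideanSpace ℝ (Fin n)} (hs : IsTubeSection Y P g S δ s)
    (hlim : TendstoUniformlyOn (fun t a => fderiv ℝ s (a, t) - frame P g (s (a, t))) 0 (𝓝[>] 0) S)
    (hε : 0 < ε) :
    ∀ᶠ t in 𝓝[>] 0, ∀ a ∈ S, ∀ t' ∈ Icc (t / 2) t,
      ‖direction P g (s (a, t)) - direction P g (s (a, t'))‖ ≤ ε := by
  obtain ⟨τ₀, hτ₀, hsmall⟩ :=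
    mem_nhdsGT_iff_exists_Ioo_subset.1 (Metric.tendstoUniformlyOn_iff.1 hlim ε hε)
  filter_upwards [Ioo_mem_nhdsGT hs.height_pos, Ioo_mem_nhdsGT hτ₀] with t htδ htτ₀ a ha t' ht'
  have ht'0 : 0 < t' := (half_pos htδ.1).trans_le ht'.1
  have hmem {τ} (hτ : τ ∈ Icc t' t) : (a, τ) ∈ S ×ˢ Ioo 0 δ :=
    ⟨ha, ht'0.trans_le hτ.1, hτ.2.trans_lt htδ.2⟩
  have hdir {τ} (hτ : τ ∈ Icc t' t) : direction P g (s (a, τ)) = τ⁻¹ • (s (a, τ) - g a) :=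
    hs.direction_eq (hmem hτ)
  rw [hdir (right_mem_Icc.2 ht'.2), hdir (left_mem_Icc.2 ht'.2)]
  refine norm_inv_smul_sub_inv_smul_le (c := fun τ => s (a, τ) - g a)
    (c' := fun τ => fderiv ℝ s (a, τ) (0, 1)) ht'0 ht'.2 (by linarith [ht'.1]) (fun τ hτ => ?_)
    fun τ hτ => ?_
  · exact ((hs.hasFDerivAt (hmem hτ)).comp_hasDerivAt τ
      ((hasDerivAt_const τ a).prodMk (hasDerivAt_id τ))).sub_const _
  · have hττ₀ := hsmall ⟨(hmem hτ).2.1, hτ.2.trans_lt htτ₀.2⟩ a ha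
    rw [Pi.zero_apply, dist_zero_left] at hττ₀
    have hle := ContinuousLinearMap.le_of_opNorm_le _ hττ₀.le ((0 : A), (1 : ℝ))
    simpa [frame_apply, hdir hτ] using hle

variable {n d : ℕ} {X Y U : Set (EuclideanSpace ℝ (Fin n))}
  {P : EuclideanSpace ℝ (Fin n) →L[ℝ] (Fin d → ℝ)} {g : (Fin d → ℝ) → EuclideanSpace ℝ (Fin n)}
  {W S : Set (Fin d → ℝ)} {s : (Fin d → ℝ) × ℝ → EuclideanSpace ℝ (Fin n)}
  {x : EuclideanSpace ℝ (Fin n)} {δ : ℝ}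

lemma IsGraphOn.exists_forall_direction_section_eq (h : IsGraphOn X P g U W) (hx : x ∈ X ∩ U)
    (hS : S ∈ 𝓝 (P x)) (hloc : ∀ᶠ y in 𝓝 x, y ∈ Y → s (footHeight P g y) = y) :
    ∃ ρ > 0, ∀ p ∈ X, ‖p - x‖ < ρ → P p ∈ S ∧ ∀ u t, 0 < t → t < ρ → IsFiberDirection Y P p u t →
      direction P g (s (P p, t)) = u := by
  obtain ⟨r, hr, hball⟩ := Metric.mem_nhds_iff.1 (hloc.and
    ((h.isOpen_source.eventually_mem hx.2).and (P.continuous.continuousAt.eventually_mem hS)))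
  refine ⟨r / 2, half_pos hr, fun p hp hpx => ?_⟩
  have hpr := hball (mem_ball_iff_norm.2 (hpx.trans (half_lt_self hr)))
  refine ⟨hpr.2.2, fun u t ht htr hu => ?_⟩
  have hy : p + t • u ∈ Metric.ball x r := by
    rw [mem_ball_iff_norm, add_sub_right_comm]
    calc ‖p - x + t • u‖ ≤ ‖p - x‖ + t := by
          refine norm_add_le_of_le le_rfl ?_
          rw [norm_smul, hu.norm_eq_one, Real.norm_of_nonneg ht.le, mul_one]
      _ < r := by linarith
  rw [← hu.footHeight_eq h ⟨hp, hpr.2.1⟩ ht, (hball hy).1 hu.2.2,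
    hu.direction_eq h ⟨hp, hpr.2.1⟩ ht]

lemma IsTubeSection.isFiberDirection (hs : IsTubeSection Y P g S δ s) (h : IsGraphOn X P g U W)
    (hdisj : Disjoint X Y) {z : (Fin d → ℝ) × ℝ} (hz : z ∈ S ×ˢ Ioo 0 δ) (hzW : z.1 ∈ W) :
    IsFiberDirection Y P (g z.1) (direction P g (s z)) z.2 := by
  have hW : P (s z) ∈ W := by rwa [hs.map_eq hz]
  have hdir := h.isFiberDirection (hs.mapsTo hz) hW (h.ne_foot hdisj (hs.mapsTo hz) hW)
  rwa [hs.norm_sub_foot hz, hs.map_eq hz] at hdir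

lemma IsTubeSection.exists_forall_directionOscillation_le (h : IsGraphOn X P g U W)
    (hs : IsTubeSection Y P g S δ s) (hx : x ∈ X ∩ U) (hxS : P x ∈ S)
    (hloc : ∀ᶠ y in 𝓝 x, y ∈ Y → s (footHeight P g y) = y)
    (hlim : TendstoUniformlyOn (fun t a => fderiv ℝ s (a, t) - frame P g (s (a, t))) 0 (𝓝[>] 0) S) :
    ∃ ρ > 0, ∀ σ > 0, ∃ t₀ > 0, ∀ t, DirectionOscillation X Y P x ρ σ t → t₀ ≤ t := by
  obtain ⟨ρ, hρ, hdir⟩ :=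
    h.exists_forall_direction_section_eq hx (hs.isOpen_base.mem_nhds hxS) hloc
  refine ⟨ρ, hρ, fun σ hσ => ?_⟩
  obtain ⟨t₀, ht₀, hsmall⟩ := mem_nhdsGT_iff_exists_Ioo_subset.1
    (hs.eventually_norm_direction_sub_le hlim (half_pos hσ))
  refine ⟨t₀, ht₀, fun t ⟨ht, htρ, p, hp, hpx, u, u', t', h2t, htt', hu, hu', hσu⟩ =>
    not_lt.1 fun htt₀ => ?_⟩
  obtain ⟨hpS, hpdir⟩ := hdir p hp (lt_of_pow_lt_pow_left₀ 2 hρ.le hpx)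
  have hle := hsmall ⟨ht, htt₀⟩ (P p) hpS t' ⟨by linarith, htt'⟩
  rw [hpdir u t ht htρ hu, hpdir u' t' (by linarith) (htt'.trans_lt htρ) hu'] at hle
  linarith [(sq_le_sq₀ hσ.le (norm_nonneg _)).1 hσu]

variable {L : Language} [L.Structure ℝ]

lemma IsTubeSection.exists_direction_oscillation_le_rpow (hL : ExpandsRealField L)
    (hpb : IsPolynomiallyBounded L) (hX : IsDefinable L X) (hY : IsDefinable L Y)
    (h : IsGraphOn X P g U W) (hdisj : Disjoint X Y) (hs : IsTubeSection Y P g S δ s)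
    (hx : x ∈ X ∩ U) (hxS : P x ∈ S)
    (hloc : ∀ᶠ y in 𝓝 x, y ∈ Y → s (footHeight P g y) = y)
    (hlim : TendstoUniformlyOn (fun t a => fderiv ℝ s (a, t) - frame P g (s (a, t))) 0 (𝓝[>] 0) S) :
    ∃ θ > 0, ∃ S' ⊆ S, IsOpen S' ∧ P x ∈ S' ∧ ∀ᶠ t in 𝓝[>] 0, ∀ a ∈ S', ∀ t' ∈ Icc (t / 2) t,
      ‖direction P g (s (a, t)) - direction P g (s (a, t'))‖ ≤ t ^ (θ : ℝ) := by
  obtain ⟨ρ, hρ, hpos⟩ := hs.exists_forall_directionOscillation_le h hx hxS hloc hlim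
  obtain ⟨N, σ₀, hσ₀, hN⟩ :=
    hpb.exists_pow_le hL (definable_directionOscillation hL hX hY P x ρ) hpos
  have hbase : ContinuousOn g (S ∩ W) := h.contDiffOn.continuousOn.mono inter_subset_right
  refine ⟨((N + 1 : ℕ) : ℝ)⁻¹, by positivity, S ∩ W ∩ g ⁻¹' Metric.ball x ρ,
    inter_subset_left.trans inter_subset_left,
    hbase.isOpen_inter_preimage (hs.isOpen_base.inter h.isOpen_base) Metric.isOpen_ball,
    ⟨⟨hxS, h.mapsTo hx⟩, by simpa [h.leftInvOn hx] using hρ⟩, ?_⟩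
  filter_upwards [Ioo_mem_nhdsGT hs.height_pos, Ioo_mem_nhdsGT hρ,
    hs.eventually_norm_direction_sub_le hlim (half_pos (lt_min hσ₀ one_pos))]
    with t htδ htρ hsmall a ⟨⟨haS, haW⟩, hga⟩ t' ht'
  rw [Real.le_rpow_inv_iff_of_pos (norm_nonneg _) htδ.1.le (by positivity), Real.rpow_natCast]
  have hσmin := (hsmall a haS t' ht').trans_lt (half_lt_self (lt_min hσ₀ one_pos))
  set σ := ‖direction P g (s (a, t)) - direction P g (s (a, t'))‖
  rcases (show 0 ≤ σ from norm_nonneg _).eq_or_lt with hσ | hσ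
  · rw [← hσ, zero_pow N.succ_ne_zero]
    exact htδ.1.le
  have hosc : DirectionOscillation X Y P x ρ σ t :=
    ⟨htδ.1, htρ.2, g a, (h.mapsTo_symm haW).1,
      pow_lt_pow_left₀ (mem_ball_iff_norm.1 hga) (norm_nonneg _) two_ne_zero, _, _, t',
      by linarith [ht'.1], ht'.2, hs.isFiberDirection h hdisj ⟨haS, htδ⟩ haW,
      hs.isFiberDirection h hdisj
        ⟨haS, (half_pos htδ.1).trans_le ht'.1, ht'.2.trans_lt htδ.2⟩ haW, le_rfl⟩
  calc σ ^ (N + 1) ≤ σ ^ N :=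
        pow_le_pow_of_le_one hσ.le (hσmin.trans_le (min_le_right _ _)).le N.le_succ
    _ ≤ t := hN σ t hσ (hσmin.trans_le (min_le_left _ _)) hosc

lemma IsTubeSection.exists_tendstoUniformlyOn_direction (hL : ExpandsRealField L)
    (hpb : IsPolynomiallyBounded L) (hX : IsDefinable L X) (hY : IsDefinable L Y)
    (h : IsGraphOn X P g U W) (hdisj : Disjoint X Y) (hs : IsTubeSection Y P g S δ s)
    (hx : x ∈ X ∩ U) (hxS : P x ∈ S)
    (hloc : ∀ᶠ y in 𝓝 x, y ∈ Y → s (footHeight P g y) = y)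
    (hlim : TendstoUniformlyOn (fun t a => fderiv ℝ s (a, t) - frame P g (s (a, t))) 0 (𝓝[>] 0) S) :
    ∃ S' ⊆ S, IsOpen S' ∧ P x ∈ S' ∧
      ∃ u, TendstoUniformlyOn (fun t a => direction P g (s (a, t))) u (𝓝[>] 0) S' := by
  obtain ⟨θ, hθ, S', hS'S, hS', hxS', hosc⟩ :=
    hs.exists_direction_oscillation_le_rpow hL hpb hX hY h hdisj hx hxS hloc hlim
  exact ⟨S', hS'S, hS', hxS', exists_tendstoUniformlyOn_of_dyadic hθ hosc⟩

end Oscillation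

section Reflection

variable {A E : Type*} [NormedAddCommGroup E] [NormedSpace ℝ E]

/-- The extension of `h`, given on `A × (0, ∞)`, to a function on `A × ℝ` that is odd in the last
variable; the sign of `t` is written as `t • |t|⁻¹`, which is `0` for `t = 0`. -/
def oddExtension (h : A × ℝ → E) (z : A × ℝ) : E :=
  z.2 • |z.2|⁻¹ • h (z.1, |z.2|)

lemma oddExtension_of_pos (h : A × ℝ → E) {z : A × ℝ} (hz : 0 < z.2) :
    oddExtension h z = h z := by
  rw [oddExtension, abs_of_pos hz, smul_inv_smul₀ hz.ne']

lemma oddExtension_of_snd_eq_zero (h : A × ℝ → E) {z : A × ℝ} (hz : z.2 = 0) :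
    oddExtension h z = 0 := by
  rw [oddExtension, hz, zero_smul]

lemma oddExtension_neg_snd (h : A × ℝ → E) (z : A × ℝ) :
    oddExtension h (z.1, -z.2) = -oddExtension h z := by
  simp only [oddExtension, abs_neg, neg_smul]

variable [NormedAddCommGroup A]

lemma tendsto_abs_snd (a : A) :
    Tendsto (fun z : A × ℝ => |z.2|) (𝓝[{z | z.2 ≠ 0}] (a, 0)) (𝓝[>] 0) := by
  refine tendsto_nhdsWithin_iff.2 ⟨?_, eventually_mem_nhdsWithin.mono fun z hz => abs_pos.2 hz⟩
  have : Continuous fun z : A × ℝ => |z.2| := continuous_snd.abs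
  simpa only [abs_zero] using (this.tendsto (a, 0)).mono_left nhdsWithin_le_nhds

lemma tendsto_of_tendstoUniformlyOn_abs_snd {β : Type*} [UniformSpace β] {G : ℝ → A → β}
    {u : A → β} {S : Set A} {a : A} (hS : S ∈ 𝓝 a) (hu : ContinuousAt u a)
    (hG : TendstoUniformlyOn G u (𝓝[>] 0) S) :
    Tendsto (fun z : A × ℝ => G |z.2| z.1) (𝓝[{z | z.2 ≠ 0}] (a, 0)) (𝓝 (u a)) := by
  have hG' : TendstoUniformlyOn (fun z : A × ℝ => G |z.2|) u (𝓝[{z | z.2 ≠ 0}] (a, 0)) S :=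
    fun V hV => (tendsto_abs_snd a).eventually (hG V hV)
  refine hG'.tendstoLocallyUniformlyOn.tendsto_comp hu.continuousWithinAt (mem_of_mem_nhds hS) ?_
  rw [nhdsWithin_eq_nhds.2 hS]
  exact continuousAt_fst.tendsto.mono_left nhdsWithin_le_nhds

variable [NormedSpace ℝ A]

/-- The reflection `(a, t) ↦ (a, -t)`. -/
def flipSnd : (A × ℝ) ≃L[ℝ] (A × ℝ) :=
  (ContinuousLinearEquiv.refl ℝ A).prodCongr (ContinuousLinearEquiv.neg ℝ)

lemma flipSnd_apply (z : A × ℝ) : flipSnd z = (z.1, -z.2) := rfl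

lemma norm_comp_flipSnd_le (Λ : A × ℝ →L[ℝ] E) :
    ‖Λ ∘L flipSnd.toContinuousLinearMap‖ ≤ ‖Λ‖ :=
  ContinuousLinearMap.opNorm_le_bound _ (norm_nonneg _) fun z => by
    simpa [flipSnd_apply, Prod.norm_def] using Λ.le_opNorm (flipSnd z)

lemma oddExtension_eq_neg_comp_flipSnd (h : A × ℝ → E) :
    oddExtension h = -(oddExtension h ∘ flipSnd) :=
  funext fun z => by simp [flipSnd_apply, oddExtension_neg_snd]

lemma fderiv_oddExtension_flipSnd (h : A × ℝ → E) (z : A × ℝ) :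
    fderiv ℝ (oddExtension h) z =
      -(fderiv ℝ (oddExtension h) (flipSnd z) ∘L flipSnd.toContinuousLinearMap) := by
  conv_lhs => rw [oddExtension_eq_neg_comp_flipSnd, fderiv_neg,
    ContinuousLinearEquiv.comp_right_fderiv]

variable {S : Set A} {δ : ℝ} {h : A × ℝ → E} {u : A → E} {a : A}

lemma contDiffAt_oddExtension_of_pos (hS : IsOpen S) (hh : ContDiffOn ℝ 1 h (S ×ˢ Ioo 0 δ))
    {z : A × ℝ} (hz : z ∈ S ×ˢ Ioo 0 δ) :
    ContDiffAt ℝ 1 (oddExtension h) z ∧ fderiv ℝ (oddExtension h) z = fderiv ℝ h z := by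
  have hO := (hS.prod isOpen_Ioo).mem_nhds hz
  have heq : oddExtension h =ᶠ[𝓝 z] h :=
    mem_of_superset hO fun w hw => oddExtension_of_pos h hw.2.1
  exact ⟨(hh.contDiffAt hO).congr_of_eventuallyEq heq, heq.fderiv_eq⟩

lemma contDiffAt_oddExtension_of_ne_zero (hS : IsOpen S)
    (hh : ContDiffOn ℝ 1 h (S ×ˢ Ioo 0 δ)) {z : A × ℝ} (hz : z ∈ S ×ˢ Ioo (-δ) δ)
    (hz0 : z.2 ≠ 0) : ContDiffAt ℝ 1 (oddExtension h) z := by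
  rcases hz0.lt_or_gt with hneg | hpos
  · have hflip : flipSnd z ∈ S ×ˢ Ioo 0 δ := ⟨hz.1, neg_pos.2 hneg, neg_lt.1 hz.2.1⟩
    rw [oddExtension_eq_neg_comp_flipSnd]
    exact ((contDiffAt_oddExtension_of_pos hS hh hflip).1.comp z
      (flipSnd (A := A)).contDiff.contDiffAt).neg
  · exact (contDiffAt_oddExtension_of_pos hS hh ⟨hz.1, hpos, hz.2.2⟩).1

/-- The map `(b, t) ↦ t • v`, the derivative at the edge of the odd extension of a function
leaving the edge in the direction `v`. -/
def edgeDeriv : E →L[ℝ] A × ℝ →L[ℝ] E :=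
  ContinuousLinearMap.smulRightL ℝ (A × ℝ) E (ContinuousLinearMap.snd ℝ A ℝ)

lemma edgeDeriv_apply (v : E) (z : A × ℝ) : edgeDeriv v z = z.2 • v := rfl

lemma hasFDerivAt_oddExtension_edge
    (hu : Tendsto (fun z : A × ℝ => |z.2|⁻¹ • h (z.1, |z.2|)) (𝓝[{z | z.2 ≠ 0}] (a, 0))
      (𝓝 (u a))) :
    HasFDerivAt (oddExtension h) (edgeDeriv (u a)) (a, 0) := by
  rw [hasFDerivAt_iff_isLittleO, Asymptotics.isLittleO_iff]
  intro ε hε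
  filter_upwards [eventually_nhdsWithin_iff.1 (Metric.tendsto_nhds.1 hu ε hε)] with z hz
  have hsub : oddExtension h z - oddExtension h (a, 0) - edgeDeriv (u a) (z - (a, 0)) =
      z.2 • (|z.2|⁻¹ • h (z.1, |z.2|) - u a) := by
    rw [oddExtension_of_snd_eq_zero h (z := (a, 0)) rfl, edgeDeriv_apply, smul_sub, sub_zero,
      Prod.snd_sub, sub_zero, oddExtension]
  have hnorm : |z.2| ≤ ‖z - (a, 0)‖ := by
    simpa only [Prod.snd_sub, sub_zero, Real.norm_eq_abs] using (norm_snd_le (z - (a, 0)) :)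
  rw [hsub, norm_smul, Real.norm_eq_abs]
  rcases eq_or_ne z.2 0 with hz0 | hz0
  · rw [hz0, abs_zero, zero_mul]
    positivity
  · calc |z.2| * ‖|z.2|⁻¹ • h (z.1, |z.2|) - u a‖ ≤ ‖z - (a, 0)‖ * ε := by
          gcongr
          simpa only [dist_eq_norm] using (hz hz0).le
      _ = ε * ‖z - (a, 0)‖ := mul_comm _ _

lemma norm_fderiv_oddExtension_sub_edgeDeriv_le (v : E) (z : A × ℝ) :
    ‖fderiv ℝ (oddExtension h) z - edgeDeriv v‖ ≤
      ‖fderiv ℝ (oddExtension h) (z.1, |z.2|) - edgeDeriv v‖ := by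
  rcases abs_choice z.2 with habs | habs
  · rw [habs]
  · have hodd : fderiv ℝ (oddExtension h) z - edgeDeriv v =
        -((fderiv ℝ (oddExtension h) (flipSnd z) - edgeDeriv v) ∘L
          flipSnd.toContinuousLinearMap) := by
      rw [fderiv_oddExtension_flipSnd]
      ext w <;> simp [edgeDeriv_apply, flipSnd_apply, sub_eq_add_neg, add_comm]
    rw [hodd, norm_neg, habs]
    exact norm_comp_flipSnd_le _

lemma continuousAt_fderiv_oddExtension_edge (hS : IsOpen S) (hδ : 0 < δ)
    (hh : ContDiffOn ℝ 1 h (S ×ˢ Ioo 0 δ)) (ha : a ∈ S) (hu : ContinuousAt u a)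
    (hedge : ∀ b ∈ S, HasFDerivAt (oddExtension h) (edgeDeriv (u b)) (b, 0))
    (hder : TendstoUniformlyOn (fun t b => fderiv ℝ h (b, t)) (fun b => edgeDeriv (u b))
      (𝓝[>] 0) S) :
    ContinuousAt (fderiv ℝ (oddExtension h)) (a, 0) := by
  have hSa : S ∈ 𝓝 a := hS.mem_nhds ha
  have hS' : ∀ᶠ z : A × ℝ in 𝓝 (a, 0), z.1 ∈ S := continuousAt_fst hSa
  have he : ContinuousAt (fun b => (edgeDeriv (u b) : A × ℝ →L[ℝ] E)) a :=
    edgeDeriv.continuous.continuousAt.comp hu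
  have hoff : Tendsto (fderiv ℝ (oddExtension h)) (𝓝[{z | z.2 ≠ 0}] (a, 0))
      (𝓝 (edgeDeriv (u a))) := by
    rw [tendsto_iff_norm_sub_tendsto_zero]
    refine squeeze_zero' (.of_forall fun _ => norm_nonneg _)
      (.of_forall fun z => norm_fderiv_oddExtension_sub_edgeDeriv_le (u a) z)
      (tendsto_iff_norm_sub_tendsto_zero.1 ?_)
    refine (tendsto_of_tendstoUniformlyOn_abs_snd hSa he hder).congr' ?_
    filter_upwards [nhdsWithin_le_nhds hS', (tendsto_abs_snd a) (Ioo_mem_nhdsGT hδ)] with z hz ht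
    exact (contDiffAt_oddExtension_of_pos (z := (z.1, |z.2|)) hS hh ⟨hz, ht⟩).2.symm
  have hon : Tendsto (fderiv ℝ (oddExtension h)) (𝓝[{z | z.2 ≠ 0}ᶜ] (a, 0))
      (𝓝 (edgeDeriv (u a))) := by
    have hlim : Tendsto (fun z : A × ℝ => (edgeDeriv (u z.1) : A × ℝ →L[ℝ] E))
        (𝓝[{z | z.2 ≠ 0}ᶜ] (a, 0)) (𝓝 (edgeDeriv (u a))) :=
      he.tendsto.comp (continuousAt_fst.tendsto.mono_left nhdsWithin_le_nhds)
    refine hlim.congr' ?_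
    filter_upwards [nhdsWithin_le_nhds hS', self_mem_nhdsWithin] with z hz ht
    rw [← Prod.mk.eta (p := z), not_not.1 ht, (hedge z.1 hz).fderiv]
  rw [ContinuousAt, (hedge a ha).fderiv, ← nhdsWithin_univ, ← compl_union_self, nhdsWithin_union]
  exact hon.sup hoff

lemma contDiffOn_oddExtension (hS : IsOpen S) (hδ : 0 < δ)
    (hh : ContDiffOn ℝ 1 h (S ×ˢ Ioo 0 δ))
    (hval : TendstoUniformlyOn (fun t a => t⁻¹ • h (a, t)) u (𝓝[>] 0) S)
    (hder : TendstoUniformlyOn (fun t a => fderiv ℝ h (a, t)) (fun a => edgeDeriv (u a))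
      (𝓝[>] 0) S) :
    ContDiffOn ℝ 1 (oddExtension h) (S ×ˢ Ioo (-δ) δ) ∧
      ∀ a ∈ S, HasFDerivAt (oddExtension h) (edgeDeriv (u a)) (a, 0) := by
  have hO : IsOpen (S ×ˢ Ioo (-δ) δ) := hS.prod isOpen_Ioo
  have hu : ContinuousOn u S := hval.continuousOn <| Eventually.frequently <| by
    filter_upwards [Ioo_mem_nhdsGT hδ] with t ht
    exact (hh.continuousOn.comp (by fun_prop) fun a ha => ⟨ha, ht⟩).const_smul t⁻¹
  have huAt : ∀ a ∈ S, ContinuousAt u a := fun a ha => hu.continuousAt (hS.mem_nhds ha)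
  have hedge : ∀ a ∈ S, HasFDerivAt (oddExtension h) (edgeDeriv (u a)) (a, 0) := fun a ha =>
    hasFDerivAt_oddExtension_edge
      (tendsto_of_tendstoUniformlyOn_abs_snd (hS.mem_nhds ha) (huAt a ha) hval)
  have hoff := fun z => contDiffAt_oddExtension_of_ne_zero (z := z) hS hh
  refine ⟨?_, hedge⟩
  rw [show (1 : WithTop ℕ∞) = 0 + 1 from rfl, contDiffOn_succ_iff_fderiv_of_isOpen hO]
  refine ⟨?_, by simp, contDiffOn_zero.2 ?_⟩
  · rintro ⟨b, t⟩ hz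
    rcases eq_or_ne t 0 with rfl | ht
    · exact (hedge b hz.1).differentiableAt.differentiableWithinAt
    · exact ((hoff _ hz ht).differentiableAt one_ne_zero).differentiableWithinAt
  · rintro ⟨b, t⟩ hz
    refine ContinuousAt.continuousWithinAt ?_
    rcases eq_or_ne t 0 with rfl | ht
    · exact continuousAt_fderiv_oddExtension_edge hS hδ hh hz.1 (huAt b hz.1) hedge hder
    · exact (hoff _ hz ht).continuousAt_fderiv one_ne_zero

end Reflection

section EdgeExtension

variable {A E : Type*} [NormedAddCommGroup E] [NormedSpace ℝ E]

/-- The extension of a section `s` over `S × (0, δ)` across the edge `S × {0}`, where it takes the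
values of `g`; the difference from `g` is extended as an odd function of the height. -/
def edgeExtension (g : A → E) (s : A × ℝ → E) (z : A × ℝ) : E :=
  g z.1 + oddExtension (fun w => s w - g w.1) z

variable {g : A → E} {s : A × ℝ → E} {z : A × ℝ}

lemma edgeExtension_of_pos (hz : 0 < z.2) : edgeExtension g s z = s z := by
  rw [edgeExtension, oddExtension_of_pos _ hz, add_sub_cancel]

lemma edgeExtension_of_snd_eq_zero (hz : z.2 = 0) : edgeExtension g s z = g z.1 := by
  rw [edgeExtension, oddExtension_of_snd_eq_zero _ hz, add_zero]

variable [NormedAddCommGroup A] [NormedSpace ℝ A] {X U : Set E} {P : E →L[ℝ] A} {W : Set A}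

lemma IsGraphOn.injective_fderiv_comp_fst_add_edgeDeriv (h : IsGraphOn X P g U W) {a : A}
    (ha : a ∈ W) {v : E} (hv : P v = 0) (hv0 : v ≠ 0) :
    Function.Injective
      (fderiv ℝ g a ∘L ContinuousLinearMap.fst ℝ A ℝ + edgeDeriv v : A × ℝ →L[ℝ] E) := by
  refine (injective_iff_map_eq_zero _).2 fun b hb => ?_
  have hsum : fderiv ℝ g a b.1 + b.2 • v = 0 := hb
  have hfst : b.1 = 0 := by simpa [h.map_fderiv ha, hv] using congrArg P hsum
  rw [hfst, map_zero, zero_add] at hsum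
  exact Prod.ext hfst ((smul_eq_zero.1 hsum).resolve_right hv0)

lemma IsGraphOn.footHeight_eq (h : IsGraphOn X P g U W) {y : E} (hy : y ∈ X ∩ U) :
    footHeight P g y = (P y, 0) := by
  rw [footHeight, h.leftInvOn hy, sub_self, norm_zero]

end EdgeExtension

section TubeSectionEdge

variable {n : ℕ} {A : Type*} [NormedAddCommGroup A] [NormedSpace ℝ A]
  {X Y U : Set (EuclideanSpace ℝ (Fin n))} {P : EuclideanSpace ℝ (Fin n) →L[ℝ] A}
  {g : A → EuclideanSpace ℝ (Fin n)} {W S S' : Set A} {δ : ℝ}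
  {s : A × ℝ → EuclideanSpace ℝ (Fin n)} {u : A → EuclideanSpace ℝ (Fin n)}

lemma IsTubeSection.mono (hs : IsTubeSection Y P g S δ s) (hS' : IsOpen S') (hS'S : S' ⊆ S) :
    IsTubeSection Y P g S' δ s :=
  have hsub : S' ×ˢ Ioo 0 δ ⊆ S ×ˢ Ioo 0 δ := prod_mono hS'S subset_rfl
  ⟨hS', hs.height_pos, hs.contDiffOn.mono hsub, hs.mapsTo.mono_left hsub,
    hs.rightInvOn.mono hsub⟩

lemma IsTubeSection.tendstoUniformlyOn_fderiv_sub (hs : IsTubeSection Y P g S δ s)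
    (h : IsGraphOn X P g U W) (hSW : S ⊆ W)
    (hlim : TendstoUniformlyOn (fun t a => fderiv ℝ s (a, t) - frame P g (s (a, t))) 0 (𝓝[>] 0) S)
    (hu : TendstoUniformlyOn (fun t a => direction P g (s (a, t))) u (𝓝[>] 0) S) :
    TendstoUniformlyOn (fun t a => fderiv ℝ (fun w => s w - g w.1) (a, t))
      (fun a => edgeDeriv (u a)) (𝓝[>] 0) S := by
  have hsum := hlim.add
    ((edgeDeriv (A := A)).uniformContinuous.comp_tendstoUniformlyOn hu)
  rw [show (0 : A → A × ℝ →L[ℝ] EuclideanSpace ℝ (Fin n)) + edgeDeriv ∘ u =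
    fun a => edgeDeriv (u a) from zero_add _] at hsum
  refine hsum.congr ?_
  filter_upwards [Ioo_mem_nhdsGT hs.height_pos] with t ht a ha
  have hderiv := (hs.hasFDerivAt (z := (a, t)) ⟨ha, ht⟩).sub
    (HasFDerivAt.comp (a, t) (h.hasFDerivAt (hSW ha)) hasFDerivAt_fst)
  have hframe : frame P g (s (a, t)) =
      fderiv ℝ g a ∘L .fst ℝ A ℝ + edgeDeriv (direction P g (s (a, t))) := by
    refine ContinuousLinearMap.ext fun b => ?_
    simp [frame_apply, edgeDeriv_apply, hs.map_eq (z := (a, t)) ⟨ha, ht⟩]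
  change fderiv ℝ s (a, t) - frame P g (s (a, t)) + edgeDeriv (direction P g (s (a, t))) = _
  rw [hframe, sub_add_eq_sub_sub, sub_add_cancel]
  exact hderiv.fderiv.symm

lemma IsTubeSection.contDiffOn_edgeExtension (hs : IsTubeSection Y P g S δ s)
    (h : IsGraphOn X P g U W) (hSW : S ⊆ W)
    (hlim : TendstoUniformlyOn (fun t a => fderiv ℝ s (a, t) - frame P g (s (a, t))) 0 (𝓝[>] 0) S)
    (hu : TendstoUniformlyOn (fun t a => direction P g (s (a, t))) u (𝓝[>] 0) S) :
    ContDiffOn ℝ 1 (edgeExtension g s) (S ×ˢ Ioo (-δ) δ) ∧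
      ∀ a ∈ S, HasFDerivAt (edgeExtension g s) (fderiv ℝ g a ∘L .fst ℝ A ℝ + edgeDeriv (u a))
        (a, 0) := by
  have hfoot : ∀ I : Set ℝ, ContDiffOn ℝ 1 (fun z : A × ℝ => g z.1) (S ×ˢ I) := fun I =>
    h.contDiffOn.comp contDiffOn_fst fun z hz => hSW hz.1
  have hval : TendstoUniformlyOn (fun t a => t⁻¹ • (s (a, t) - g a)) u (𝓝[>] 0) S := by
    refine hu.congr ?_
    filter_upwards [Ioo_mem_nhdsGT hs.height_pos] with t ht a ha
    exact hs.direction_eq ⟨ha, ht⟩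
  obtain ⟨hodd, hedge⟩ := contDiffOn_oddExtension hs.isOpen_base hs.height_pos
    (hs.contDiffOn.sub (hfoot _)) hval (hs.tendstoUniformlyOn_fderiv_sub h hSW hlim hu)
  exact ⟨(hfoot _).add hodd, fun a ha =>
    (HasFDerivAt.comp (a, 0) (h.hasFDerivAt (hSW ha)) hasFDerivAt_fst).add (hedge a ha)⟩

end TubeSectionEdge

lemma IsTubeSection.norm_eq_one_and_map_eq_zero_of_tendsto {n d : ℕ}
    {X Y U : Set (EuclideanSpace ℝ (Fin n))} {P : EuclideanSpace ℝ (Fin n) →L[ℝ] (Fin d → ℝ)}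
    {g : (Fin d → ℝ) → EuclideanSpace ℝ (Fin n)} {W S : Set (Fin d → ℝ)} {δ : ℝ}
    {s : (Fin d → ℝ) × ℝ → EuclideanSpace ℝ (Fin n)} {a : Fin d → ℝ}
    {v : EuclideanSpace ℝ (Fin n)} (hs : IsTubeSection Y P g S δ s) (h : IsGraphOn X P g U W)
    (hdisj : Disjoint X Y) (ha : a ∈ S) (haW : a ∈ W)
    (hv : Tendsto (fun t => direction P g (s (a, t))) (𝓝[>] 0) (𝓝 v)) : ‖v‖ = 1 ∧ P v = 0 := by
  have hdir : ∀ᶠ t in 𝓝[>] 0, IsFiberDirection Y P (g a) (direction P g (s (a, t))) t := by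
    filter_upwards [Ioo_mem_nhdsGT hs.height_pos] with t ht
    exact hs.isFiberDirection h hdisj ⟨ha, ht⟩ haW
  exact ⟨tendsto_nhds_unique hv.norm
      (tendsto_const_nhds.congr' (hdir.mono fun t ht => ht.norm_eq_one.symm)),
    tendsto_nhds_unique ((P.continuous.tendsto v).comp hv)
      (tendsto_const_nhds.congr' (hdir.mono fun t ht => ht.2.1.symm))⟩

section Straightening

variable {E B : Type*} [NormedAddCommGroup E] [NormedSpace ℝ E] [FiniteDimensional ℝ E]
  [NormedAddCommGroup B] [NormedSpace ℝ B] {m : ℕ}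

lemma exists_continuousLinearEquiv_eq_coprod (hm : Module.finrank ℝ B + m = Module.finrank ℝ E)
    {Λ : B →L[ℝ] E} (hΛ : Function.Injective Λ) :
    ∃ (C : (Fin m → ℝ) →L[ℝ] E) (e : (B × (Fin m → ℝ)) ≃L[ℝ] E),
      (e : B × (Fin m → ℝ) →L[ℝ] E) = Λ.coprod C := by
  have : FiniteDimensional ℝ B := .of_injective Λ.toLinearMap hΛ
  obtain ⟨Q, hQ⟩ := Submodule.exists_isCompl Λ.toLinearMap.range
  have hfinrank : Module.finrank ℝ (Fin m → ℝ) = Module.finrank ℝ Q := by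
    have hsum := Submodule.finrank_add_eq_of_isCompl hQ
    rw [LinearMap.finrank_range_of_inj hΛ] at hsum
    rw [Module.finrank_fin_fun]
    omega
  let f : (Fin m → ℝ) ≃ₗ[ℝ] Q := .ofFinrankEq _ _ hfinrank
  exact ⟨(Q.subtype ∘ₗ f.toLinearMap).toContinuousLinearMap,
    (((LinearEquiv.ofInjective Λ.toLinearMap hΛ).prodCongr f).trans
      (Submodule.prodEquivOfIsCompl _ _ hQ)).toContinuousLinearEquiv, rfl⟩

lemma exists_openPartialHomeomorph_straightening
    (hm : Module.finrank ℝ B + m = Module.finrank ℝ E) {F : B → E} {F' : B →L[ℝ] E} {b : B}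
    (hF : ContDiffAt ℝ 1 F b) (hF' : HasFDerivAt F F' b) (hinj : Function.Injective F') :
    ∃ φ : OpenPartialHomeomorph (B × (Fin m → ℝ)) E, (b, 0) ∈ φ.source ∧
      (∀ z, φ (z, 0) = F z) ∧ ContDiffOn ℝ 1 φ φ.source ∧ ContDiffOn ℝ 1 φ.symm φ.target := by
  have : FiniteDimensional ℝ B := .of_injective F'.toLinearMap hinj
  obtain ⟨C, e, he⟩ := exists_continuousLinearEquiv_eq_coprod hm hinj
  have hderiv : HasFDerivAt (fun q : B × (Fin m → ℝ) => F q.1 + C q.2)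
      (e : B × (Fin m → ℝ) →L[ℝ] E) (b, 0) := by
    rw [he, ← ContinuousLinearMap.comp_fst_add_comp_snd]
    exact (HasFDerivAt.comp (b, 0) hF' hasFDerivAt_fst).add
      (C.hasFDerivAt.comp (b, 0) hasFDerivAt_snd)
  obtain ⟨φ, hb, hφ, hsmooth⟩ := exists_openPartialHomeomorph_contDiffOn
    ((ContDiffAt.comp (b, 0) hF contDiffAt_fst).add (C.contDiff.comp contDiff_snd).contDiffAt)
    hderiv
  exact ⟨φ, hb, fun z => by simp [hφ], hsmooth⟩

end Straightening

lemma eventually_mem_iff_symm_mem_of_parametrization {E B C : Type*} [TopologicalSpace E]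
    [TopologicalSpace B] [TopologicalSpace C] [Zero C] {φ : OpenPartialHomeomorph (B × C) E}
    {F : B → E} {f : E → B} {D : Set B} {M : Set E} {x : E} (hφ : ∀ z, φ (z, 0) = F z)
    (hx : (f x, 0) ∈ φ.source) (hFx : F (f x) = x) (hf : ContinuousAt f x)
    (hF : ∀ᶠ z in 𝓝 (f x), z ∈ D → F z ∈ M) (hM : ∀ᶠ y in 𝓝 x, y ∈ M → f y ∈ D ∧ F (f y) = y) :
    ∀ᶠ y in 𝓝 x, y ∈ M ↔ (φ.symm y).1 ∈ D ∧ (φ.symm y).2 = 0 := by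
  have hφx : φ (f x, 0) = x := (hφ _).trans hFx
  have hxt : x ∈ φ.target := hφx ▸ φ.map_source hx
  have hsymm : φ.symm x = (f x, 0) := by simpa only [hφx] using φ.left_inv hx
  have hFsymm : ∀ᶠ y in 𝓝 x, (φ.symm y).1 ∈ D → F (φ.symm y).1 ∈ M := by
    refine (φ.symm.continuousAt hxt).fst.eventually (p := fun z => z ∈ D → F z ∈ M) ?_
    simpa only [hsymm] using hF
  filter_upwards [hFsymm, hM, φ.open_target.eventually_mem hxt,
    (hf.prodMk continuousAt_const).eventually_mem (φ.open_source.mem_nhds hx)]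
    with y hFy hMy hyt hys
  constructor
  · intro hy
    have : φ.symm y = (f y, 0) := by
      rw [← φ.left_inv hys, hφ, (hMy hy).2]
    simpa [this] using (hMy hy).1
  · rintro ⟨hD, h0⟩
    have hy : F (φ.symm y).1 = y := by
      rw [← hφ, ← h0, Prod.mk.eta, φ.right_inv hyt]
    exact hy ▸ hFy hD

section FlatCoordinates

variable {n d : ℕ} {z : EuclideanSpace ℝ (Fin n)}

lemma mem_flat_iff (hdn : d < n) :
    z ∈ flat n d ↔ z ⟨d, hdn⟩ = 0 ∧ normalCoord n (d + 1) z = 0 := by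
  rw [normalCoord_eq_zero_iff]
  refine ⟨fun h => ⟨h _ le_rfl, fun i hi => h i (by omega)⟩, fun h i hi => ?_⟩
  rcases hi.eq_or_lt with rfl | hi
  · exact h.1
  · exact h.2 i hi

lemma mem_halfFlat_iff (hdn : d < n) :
    z ∈ halfFlat n d ↔ 0 ≤ z ⟨d, hdn⟩ ∧ normalCoord n (d + 1) z = 0 := by
  rw [normalCoord_eq_zero_iff, and_comm]
  refine and_congr_right fun _ => ⟨fun h => h _ rfl, ?_⟩
  rintro h i rfl
  exact h

lemma exists_flatCoordinates (hdn : d < n) :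
    ∃ J : EuclideanSpace ℝ (Fin n) ≃L[ℝ] ((Fin d → ℝ) × ℝ) × (Fin (n - (d + 1)) → ℝ),
      ∀ z, (J z).1.2 = z ⟨d, hdn⟩ ∧ (J z).2 = normalCoord n (d + 1) z := by
  let J : EuclideanSpace ℝ (Fin n) →L[ℝ] ((Fin d → ℝ) × ℝ) × (Fin (n - (d + 1)) → ℝ) :=
    ((ContinuousLinearMap.pi fun i : Fin d => EuclideanSpace.proj (⟨i, by omega⟩ : Fin n)).prod
      (EuclideanSpace.proj ⟨d, hdn⟩)).prod (normalCoord n (d + 1))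
  have hinj : Function.Injective J.toLinearMap := by
    refine (injective_iff_map_eq_zero _).2 fun z hz => ?_
    have hfirst : (J z).1.1 = 0 := congrArg (fun q => q.1.1) hz
    have hflat : z ∈ flat n d :=
      (mem_flat_iff hdn).2 ⟨congrArg (fun q => q.1.2) hz, congrArg (fun q => q.2) hz⟩
    ext i
    rcases lt_or_ge (i : ℕ) d with hi | hi
    · exact congrFun hfirst ⟨i, hi⟩
    · exact hflat i hi
  exact ⟨(LinearEquiv.ofInjectiveOfFinrankEq J.toLinearMap hinj
    (by simp; omega)).toContinuousLinearEquiv, fun z => ⟨rfl, rfl⟩⟩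

end FlatCoordinates

section Charts

variable {k : WithTop ℕ∞} {n d : ℕ} {M B X Y : Set (EuclideanSpace ℝ (Fin n))}
  {Φ : OpenPartialHomeomorph (EuclideanSpace ℝ (Fin n)) (EuclideanSpace ℝ (Fin n))}
  {U : Set (EuclideanSpace ℝ (Fin n))} {x : EuclideanSpace ℝ (Fin n)}

/-- A `C^k` chart of a `(d + 1)`-dimensional manifold `M` whose domain avoids the boundary `B`. -/
def IsInteriorChart (k : WithTop ℕ∞) (d : ℕ) (M B : Set (EuclideanSpace ℝ (Fin n)))
    (Φ : OpenPartialHomeomorph (EuclideanSpace ℝ (Fin n)) (EuclideanSpace ℝ (Fin n))) : Prop :=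
  IsDiffeo k Φ ∧ ∀ x ∈ Φ.source, (x ∈ M ↔ Φ x ∈ flat n (d + 1)) ∧ x ∉ B

/-- A `C^k` chart which straightens both a `(d + 1)`-dimensional manifold `M` with boundary and
its boundary `B`. -/
def IsBoundaryChart (k : WithTop ℕ∞) (d : ℕ) (M B : Set (EuclideanSpace ℝ (Fin n)))
    (Φ : OpenPartialHomeomorph (EuclideanSpace ℝ (Fin n)) (EuclideanSpace ℝ (Fin n))) : Prop :=
  IsDiffeo k Φ ∧ ∀ x ∈ Φ.source, (x ∈ M ↔ Φ x ∈ halfFlat n d) ∧ (x ∈ B ↔ Φ x ∈ flat n d)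

lemma IsDiffeo.restrOpen (hΦ : IsDiffeo k Φ) (hU : IsOpen U) : IsDiffeo k (Φ.restrOpen U hU) :=
  ⟨hΦ.1.mono inter_subset_left, hΦ.2.mono inter_subset_left⟩

lemma IsInteriorChart.restrOpen (hΦ : IsInteriorChart k d M B Φ) (hU : IsOpen U) :
    IsInteriorChart k d (M ∩ U) (B ∩ U) (Φ.restrOpen U hU) :=
  ⟨hΦ.1.restrOpen hU, fun x hx => ⟨(and_iff_left hx.2).trans (hΦ.2 x hx.1).1,
    fun hxB => (hΦ.2 x hx.1).2 hxB.1⟩⟩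

lemma IsBoundaryChart.restrOpen (hΦ : IsBoundaryChart k d M B Φ) (hU : IsOpen U) :
    IsBoundaryChart k d (M ∩ U) (B ∩ U) (Φ.restrOpen U hU) :=
  ⟨hΦ.1.restrOpen hU, fun x hx => ⟨(and_iff_left hx.2).trans (hΦ.2 x hx.1).1,
    (and_iff_left hx.2).trans (hΦ.2 x hx.1).2⟩⟩

lemma isSubmanifoldWithBoundary_inter (hdn : d < n) (hBM : B ⊆ M) (hU : IsOpen U)
    (hint : ∀ p ∈ (M \ B) ∩ U, ∃ Φ, p ∈ Φ.source ∧ IsInteriorChart k d M B Φ)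
    (hbdry : ∀ p ∈ B ∩ U, ∃ Φ, p ∈ Φ.source ∧ IsBoundaryChart k d M B Φ) :
    IsSubmanifoldWithBoundary k d (M ∩ U) (B ∩ U) := by
  refine ⟨hdn, inter_subset_inter_left U hBM, fun p hp => ?_, fun p hp => ?_⟩
  · obtain ⟨Φ, hpΦ, hΦ⟩ := hint p ⟨⟨hp.1.1, fun hpB => hp.2 ⟨hpB, hp.1.2⟩⟩, hp.1.2⟩
    exact ⟨Φ.restrOpen U hU, ⟨hpΦ, hp.1.2⟩, hΦ.restrOpen hU⟩
  · obtain ⟨Φ, hpΦ, hΦ⟩ := hbdry p hp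
    exact ⟨Φ.restrOpen U hU, ⟨hpΦ, hp.2⟩, hΦ.restrOpen hU⟩

lemma IsSubmanifold.exists_isInteriorChart (hY : IsSubmanifold k (d + 1) Y)
    (hdisj : Disjoint X Y) (hXY : X ⊆ closure Y) (hx : x ∈ Y) :
    ∃ Φ, x ∈ Φ.source ∧ IsInteriorChart k d (X ∪ Y) X Φ := by
  obtain ⟨Φ, hxΦ, hΦ, hYΦ⟩ := hY.2 x hx
  have hclosed : IsClosed (flat n (d + 1)) := by
    have hflat : flat n (d + 1) = normalCoord n (d + 1) ⁻¹' {0} :=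
      Set.ext fun _ => normalCoord_eq_zero_iff.symm
    exact hflat ▸ isClosed_singleton.preimage (normalCoord n (d + 1)).continuous
  have hX : ∀ y ∈ Φ.source, y ∉ X := by
    intro y hy hyX
    have hoff : Φ y ∉ flat n (d + 1) := fun h => disjoint_left.1 hdisj hyX ((hYΦ y hy).2 h)
    obtain ⟨w, hw, hwY⟩ := mem_closure_iff.1 (hXY hyX) _
      (Φ.isOpen_inter_preimage hclosed.isOpen_compl) ⟨hy, hoff⟩
    exact hw.2 ((hYΦ w hw.1).1 hwY)
  exact ⟨Φ, hxΦ, hΦ, fun y hy => ⟨(or_iff_right (hX y hy)).trans (hYΦ y hy), hX y hy⟩⟩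

lemma exists_isBoundaryChart_of_eventually (hdn : d < n)
    {φ : OpenPartialHomeomorph (((Fin d → ℝ) × ℝ) × (Fin (n - (d + 1)) → ℝ))
      (EuclideanSpace ℝ (Fin n))}
    (hφ : ContDiffOn ℝ k φ φ.source) (hφ' : ContDiffOn ℝ k φ.symm φ.target) (hx : x ∈ φ.target)
    (hM : ∀ᶠ y in 𝓝 x, y ∈ M ↔ 0 ≤ (φ.symm y).1.2 ∧ (φ.symm y).2 = 0)
    (hB : ∀ᶠ y in 𝓝 x, y ∈ B ↔ (φ.symm y).1.2 = 0 ∧ (φ.symm y).2 = 0) :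
    ∃ Φ, x ∈ Φ.source ∧ IsBoundaryChart k d M B Φ := by
  obtain ⟨J, hJ⟩ := exists_flatCoordinates hdn
  obtain ⟨V, hV, hVo, hxV⟩ := eventually_nhds_iff.1 (hM.and hB)
  let Ψ := φ.symm.transHomeomorph J.symm.toHomeomorph
  have hJΨ : ∀ y, J (Ψ y) = φ.symm y := fun y => J.apply_symm_apply _
  have hΨ : IsDiffeo k Ψ := ⟨J.symm.contDiff.comp_contDiffOn hφ',
    hφ.comp J.contDiff.contDiffOn fun z hz => hz⟩
  refine ⟨Ψ.restrOpen V hVo, ⟨hx, hxV⟩, hΨ.restrOpen hVo, fun y hy => ?_⟩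
  change (_ ↔ Ψ y ∈ _) ∧ (_ ↔ Ψ y ∈ _)
  rw [mem_halfFlat_iff hdn, mem_flat_iff hdn, ← (hJ _).1, ← (hJ _).2, hJΨ]
  exact hV y hy.2

end Charts

section TubeSectionChart

variable {n d : ℕ} {X Y U : Set (EuclideanSpace ℝ (Fin n))}
  {P : EuclideanSpace ℝ (Fin n) →L[ℝ] (Fin d → ℝ)} {g : (Fin d → ℝ) → EuclideanSpace ℝ (Fin n)}
  {W S : Set (Fin d → ℝ)} {δ : ℝ} {s : (Fin d → ℝ) × ℝ → EuclideanSpace ℝ (Fin n)}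
  {u : (Fin d → ℝ) → EuclideanSpace ℝ (Fin n)} {x : EuclideanSpace ℝ (Fin n)}

lemma IsTubeSection.edgeExtension_mem (hs : IsTubeSection Y P g S δ s)
    (h : IsGraphOn X P g U W) (hSW : S ⊆ W) {z : (Fin d → ℝ) × ℝ} (hz : z ∈ S ×ˢ Ioo (-δ) δ) :
    (z.2 = 0 → edgeExtension g s z ∈ X) ∧ (0 ≤ z.2 → edgeExtension g s z ∈ X ∪ Y) := by
  have hX : z.2 = 0 → edgeExtension g s z ∈ X := by
    intro h0
    rw [edgeExtension_of_snd_eq_zero h0]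
    exact (h.mapsTo_symm (hSW hz.1)).1
  refine ⟨hX, fun h0 => ?_⟩
  rcases h0.eq_or_lt with h0 | h0
  · exact Or.inl (hX h0.symm)
  · rw [edgeExtension_of_pos h0]
    exact Or.inr (hs.mapsTo ⟨hz.1, h0, hz.2.2⟩)

lemma IsGraphOn.eventually_edgeExtension_footHeight (h : IsGraphOn X P g U W)
    (hdisj : Disjoint X Y) (hx : x ∈ X ∩ U)
    (hloc : ∀ᶠ y in 𝓝 x, y ∈ Y → s (footHeight P g y) = y) :
    ∀ᶠ y in 𝓝 x,
      (y ∈ X → (footHeight P g y).2 = 0 ∧ edgeExtension g s (footHeight P g y) = y) ∧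
      (y ∈ Y → 0 < (footHeight P g y).2 ∧ edgeExtension g s (footHeight P g y) = y) := by
  filter_upwards [hloc, h.isOpen_source.eventually_mem hx.2,
    P.continuous.continuousAt.eventually_mem (h.isOpen_base.mem_nhds (h.mapsTo hx))]
    with y hy hyU hyW
  refine ⟨fun hyX => ?_, fun hyY => ?_⟩
  · have hfoot := h.footHeight_eq ⟨hyX, hyU⟩
    exact ⟨by rw [hfoot], by rw [edgeExtension_of_snd_eq_zero (by rw [hfoot]), footHeight,
      h.leftInvOn ⟨hyX, hyU⟩]⟩
  · have hpos : 0 < (footHeight P g y).2 := norm_pos_iff.2 (sub_ne_zero.2 (h.ne_foot hdisj hyY hyW))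
    exact ⟨hpos, (edgeExtension_of_pos hpos).trans (hy hyY)⟩

lemma IsTubeSection.exists_openPartialHomeomorph (hs : IsTubeSection Y P g S δ s)
    (h : IsGraphOn X P g U W) (hdisj : Disjoint X Y) (hdn : d < n) (hSW : S ⊆ W)
    (hlim : TendstoUniformlyOn (fun t a => fderiv ℝ s (a, t) - frame P g (s (a, t))) 0 (𝓝[>] 0) S)
    (hu : TendstoUniformlyOn (fun t a => direction P g (s (a, t))) u (𝓝[>] 0) S)
    {a : Fin d → ℝ} (ha : a ∈ S) :
    ∃ φ : OpenPartialHomeomorph (((Fin d → ℝ) × ℝ) × (Fin (n - (d + 1)) → ℝ))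
        (EuclideanSpace ℝ (Fin n)),
      ((a, 0), 0) ∈ φ.source ∧ (∀ z, φ (z, 0) = edgeExtension g s z) ∧
      ContDiffOn ℝ 1 φ φ.source ∧ ContDiffOn ℝ 1 φ.symm φ.target := by
  obtain ⟨hnorm, hPu⟩ :=
    hs.norm_eq_one_and_map_eq_zero_of_tendsto h hdisj ha (hSW ha) (hu.tendsto_at ha)
  have hinj := h.injective_fderiv_comp_fst_add_edgeDeriv (hSW ha) hPu
    (norm_ne_zero_iff.1 (hnorm ▸ one_ne_zero))
  obtain ⟨hsmooth, hedge⟩ := hs.contDiffOn_edgeExtension h hSW hlim hu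
  have hnhds : S ×ˢ Ioo (-δ) δ ∈ 𝓝 (a, 0) := prod_mem_nhds (hs.isOpen_base.mem_nhds ha)
    (Ioo_mem_nhds (neg_lt_zero.2 hs.height_pos) hs.height_pos)
  exact exists_openPartialHomeomorph_straightening (by simp; omega)
    (hsmooth.contDiffAt hnhds) (hedge a ha) hinj

lemma IsTubeSection.exists_isBoundaryChart (hs : IsTubeSection Y P g S δ s)
    (h : IsGraphOn X P g U W) (hdisj : Disjoint X Y) (hdn : d < n) (hSW : S ⊆ W)
    (hlim : TendstoUniformlyOn (fun t a => fderiv ℝ s (a, t) - frame P g (s (a, t))) 0 (𝓝[>] 0) S)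
    (hu : TendstoUniformlyOn (fun t a => direction P g (s (a, t))) u (𝓝[>] 0) S)
    (hx : x ∈ X ∩ U) (hxS : P x ∈ S) (hloc : ∀ᶠ y in 𝓝 x, y ∈ Y → s (footHeight P g y) = y) :
    ∃ Φ, x ∈ Φ.source ∧ IsBoundaryChart 1 d (X ∪ Y) X Φ := by
  obtain ⟨φ, hsource, hφ, hsmooth, hsmooth'⟩ :=
    hs.exists_openPartialHomeomorph h hdisj hdn hSW hlim hu hxS
  have hfoot := h.footHeight_eq hx
  have hedge := h.eventually_edgeExtension_footHeight hdisj hx hloc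
  have hcont : ContinuousAt (footHeight P g) x := h.continuousOn_footHeight.continuousAt
    ((h.isOpen_base.preimage P.continuous).mem_nhds (h.mapsTo hx))
  have hmem : ∀ᶠ z in 𝓝 (footHeight P g x), z ∈ S ×ˢ Ioo (-δ) δ := by
    rw [hfoot]
    exact prod_mem_nhds (hs.isOpen_base.mem_nhds hxS)
      (Ioo_mem_nhds (neg_lt_zero.2 hs.height_pos) hs.height_pos)
  have hcover : ∀ᶠ y in 𝓝 x, y ∈ X ∪ Y →
      0 ≤ (footHeight P g y).2 ∧ edgeExtension g s (footHeight P g y) = y := by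
    filter_upwards [hedge] with y hy
    rintro (hyX | hyY)
    · exact ⟨(hy.1 hyX).1.ge, (hy.1 hyX).2⟩
    · exact ⟨(hy.2 hyY).1.le, (hy.2 hyY).2⟩
  have hfx := (hedge.self_of_nhds.1 hx.1).2
  rw [← hfoot] at hsource
  have hM := eventually_mem_iff_symm_mem_of_parametrization (M := X ∪ Y)
    (D := {z : (Fin d → ℝ) × ℝ | 0 ≤ z.2}) hφ hsource hfx hcont
    (hmem.mono fun z hz => (hs.edgeExtension_mem h hSW hz).2) hcover
  have hB := eventually_mem_iff_symm_mem_of_parametrization (M := X)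
    (D := {z : (Fin d → ℝ) × ℝ | z.2 = 0}) hφ hsource hfx hcont
    (hmem.mono fun z hz => (hs.edgeExtension_mem h hSW hz).1) (hedge.mono fun _ hy => hy.1)
  have hxt : x ∈ φ.target := by
    simpa only [hφ, hfx] using φ.map_source hsource
  exact exists_isBoundaryChart_of_eventually hdn hsmooth hsmooth' hxt hM hB

end TubeSectionChart

section Main

variable {n d : ℕ} {X Y : Set (EuclideanSpace ℝ (Fin n))} {x : EuclideanSpace ℝ (Fin n)}

lemma IsSubmanifold.exists_isGraphOn (hX : IsSubmanifold 1 d X) (hx : x ∈ X) :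
    ∃ (P : EuclideanSpace ℝ (Fin n) →L[ℝ] (Fin d → ℝ)) (g : (Fin d → ℝ) → _) (U : Set _)
      (W : Set (Fin d → ℝ)), x ∈ U ∧ IsGraphOn X P g U W := by
  obtain ⟨f, hf⟩ := LinearMap.exists_leftInverse_of_injective (tangentSpace X x).subtype
    (Submodule.ker_subtype _)
  let e : tangentSpace X x ≃ₗ[ℝ] (Fin d → ℝ) :=
    .ofFinrankEq _ _ (by rw [hX.finrank_tangentSpace hx, Module.finrank_fin_fun])
  let P : EuclideanSpace ℝ (Fin n) →L[ℝ] (Fin d → ℝ) :=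
    (e.toLinearMap ∘ₗ f).toContinuousLinearMap
  have hP : ∀ w ∈ tangentSpace X x, P w = 0 → w = 0 := by
    intro w hw hPw
    have hfw : f w = ⟨w, hw⟩ := LinearMap.congr_fun hf ⟨w, hw⟩
    have hfw' : f w = 0 := e.map_eq_zero_iff.1 hPw
    exact congrArg Subtype.val (hfw.symm.trans hfw')
  obtain ⟨g, U, W, hxU, hsheet, hg⟩ := hX.exists_isSheet (F := Fin d → ℝ)
    (Module.finrank_fin_fun ℝ) hx P.contDiff.contDiffAt P.hasFDerivAt hP
  exact ⟨P, g, U, W, hxU, hsheet, hg⟩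

variable {L : Language} [L.Structure ℝ]

lemma exists_isBoundaryChart (hL : ExpandsRealField L) (hpb : IsPolynomiallyBounded L)
    (hXdef : IsDefinable L X) (hYdef : IsDefinable L Y) (hX : IsSubmanifold 1 d X)
    (hY : IsSubmanifold 1 (d + 1) Y) (hdisj : Disjoint X Y) (hlc : IsLocallyClosed (X ∪ Y))
    (hb : ∀ x ∈ X, WhitneyBAt Y X x) (hx : x ∈ X) (hconn : ConnectedNear Y x) :
    ∃ Φ, x ∈ Φ.source ∧ IsBoundaryChart 1 d (X ∪ Y) X Φ := by
  obtain ⟨P, g, U, W, hxU, h⟩ := hX.exists_isGraphOn hx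
  have hd : Module.finrank ℝ (Fin d → ℝ) = d := Module.finrank_fin_fun ℝ
  obtain ⟨r, hr, δ, s, hrW, hs, hloc⟩ :=
    h.exists_isTubeSection hd hY hdisj hlc hb ⟨hx, hxU⟩ hconn
  have hlim := hs.tendstoUniformlyOn_fderiv_sub_frame h hd hY hdisj hb
    (isCompact_closedBall _ _) hrW Metric.ball_subset_closedBall
  obtain ⟨S, hSball, hS, hxS, u, hu⟩ := IsTubeSection.exists_tendstoUniformlyOn_direction
    hL hpb hXdef hYdef h hdisj hs ⟨hx, hxU⟩ (Metric.mem_ball_self hr) hloc hlim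
  exact (hs.mono hS hSball).exists_isBoundaryChart h hdisj hY.1
    (hSball.trans (Metric.ball_subset_closedBall.trans hrW)) (hlim.mono hSball) hu ⟨hx, hxU⟩ hxS
    hloc

theorem corollary3p11_general (hL : ExpandsRealField L) (hpb : IsPolynomiallyBounded L)
    (hXdef : IsDefinable L X) (hYdef : IsDefinable L Y)
    (hX : IsSubmanifold 1 d X) (hY : IsSubmanifold 1 (d + 1) Y)
    (hdisj : Disjoint X Y) (hXY : X ⊆ closure Y) (hlc : IsLocallyClosed (X ∪ Y))
    (hb : ∀ x ∈ X, WhitneyBAt Y X x) :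
    (∀ x ∈ X, ConnectedNear Y x →
      ∃ U : Set (EuclideanSpace ℝ (Fin n)), IsOpen U ∧ x ∈ U ∧
        IsSubmanifoldWithBoundary 1 d ((X ∪ Y) ∩ U) (X ∩ U)) ∧
    ((∀ x ∈ X, ConnectedNear Y x) → IsSubmanifoldWithBoundary 1 d (X ∪ Y) X) := by
  have hbdry : ∀ x ∈ X, ConnectedNear Y x →
      ∃ Φ, x ∈ Φ.source ∧ IsBoundaryChart 1 d (X ∪ Y) X Φ := fun x hx =>
    exists_isBoundaryChart hL hpb hXdef hYdef hX hY hdisj hlc hb hx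
  have hint : ∀ p ∈ (X ∪ Y) \ X, ∃ Φ, p ∈ Φ.source ∧ IsInteriorChart 1 d (X ∪ Y) X Φ :=
    fun p hp => hY.exists_isInteriorChart hdisj hXY (hp.1.resolve_left hp.2)
  have hmfd := fun (U : Set (EuclideanSpace ℝ (Fin n))) (hU : IsOpen U) =>
    isSubmanifoldWithBoundary_inter hY.1 subset_union_left hU fun p hp => hint p hp.1
  refine ⟨fun x hx hconn => ?_, fun hconn => ?_⟩
  · obtain ⟨Φ, hxΦ, hΦ⟩ := hbdry x hx hconn
    exact ⟨Φ.source, Φ.open_source, hxΦ, hmfd _ Φ.open_source fun p hp => ⟨Φ, hp.2, hΦ⟩⟩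
  · simpa only [inter_univ] using hmfd univ isOpen_univ fun p hp => hbdry p hp.1 (hconn p hp.1)

end Main

end WhitneyPawlucki

end

open WhitneyPawlucki in
theorem corollary3p11 (L : FirstOrder.Language) [L.Structure ℝ]
    (hL : IsOMinimal L) (hpb : IsPolynomiallyBounded L)
    {n d : ℕ} (X Y : Set (EuclideanSpace ℝ (Fin n)))
    (hXdef : IsDefinable L X) (hYdef : IsDefinable L Y)
    (hX : IsSubmanifold 2 d X) (hY : IsSubmanifold 2 (d + 1) Y)
    (hdisj : Disjoint X Y) (hXY : X ⊆ closure Y) (hlc : IsLocallyClosed (X ∪ Y))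
    (hb : ∀ x ∈ X, WhitneyBAt Y X x) :
    (∀ x ∈ X, ConnectedNear Y x →
      ∃ U : Set (EuclideanSpace ℝ (Fin n)), IsOpen U ∧ x ∈ U ∧
        IsSubmanifoldWithBoundary 1 d ((X ∪ Y) ∩ U) (X ∩ U)) ∧
    ((∀ x ∈ X, ConnectedNear Y x) → IsSubmanifoldWithBoundary 1 d (X ∪ Y) X) :=
  corollary3p11_general hL.expandsRealField hpb hXdef hYdef (hX.of_le one_le_two)
    (hY.of_le one_le_two) hdisj hXY hlc hb
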